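/- Let $n,s\ge 0$ and $J\ge 1$ be integers. For $j=1,\dots,J$ let $\mathcal S_j\subseteq\{1,\dots,n\}$ be a set of at most $s$ qubits, let $h_{(j)}$ be a positive semi-definite matrix acting on the qubits of $\mathcal S_j$ (so of size $2^{|\mathcal S_j|}\times 2^{|\mathcal S_j|}$) with operator norm $\|h_{(j)}\|\le 2$, and let $H_{(j)}=h_{(j)}\otimes I_{\neg\mathcal S_j}$ be the operator on $n$ qubits that applies $h_{(j)}$ to the qubits of $\mathcal S_j$. Put $A=\sum_{j=1}^J H_{(j)}\in\mathbb C^{2^n\times 2^n}$ and $B=I-\frac1J A$. With $w_{(j)}=I-h_{(j)}$ let $$u_{(j)}=\begin{pmatrix} w_{(j)} & -\sqrt{I-w_{(j)}^2}\\ \sqrt{I-w_{(j)}^2} & w_{(j)}\end{pmatrix}$$ be the dilation of $w_{(j)}$, which acts on the qubits of $\mathcal S_j$ and on one ancilla qubit (the same for all $j$), and let $U_{(j)}=u_{(j)}\otimes I_{\neg\mathcal S_j}$. On a control register of $\lceil\log_2 J\rceil$ further qubits, whose first $J$ basis states are denoted $|1\rangle_c,\dots,|J\rangle_c$ (the first of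 them being the all-zeros state $|0\cdots0\rangle_c$), let $U_{\textsc{Select}}=\sum_{j=1}^J|j\rangle\langle j|_c\otimes U_{(j)}$, extended by the identity on the remaining basis states of the control register. For a unitary $\mathrm{Had}$ on the control register with $\mathrm{Had}\,|0\cdots0\rangle_c=\frac1{\sqrt J}\sum_{j=1}^J|j\rangle_c$ put $\mathcal U_B=(\mathrm{Had}^\dagger\otimes I)\,U_{\textsc{Select}}\,(\mathrm{Had}\otimes I)$. Then: 1. For every such $\mathrm{Had}$, the operator $\mathcal U_B$ is a normalised (exact) matrix-block-encoding of $B$ with $a=\lceil\log_2 J\rceil+1$ ancilla qubits, that is, $\mathcal U_B$ is unitary and $(\langle 0^a|\otimes I)\,\mathcal U_B\,(|0^a\rangle\otimes I)=B$. 2. The gate complexity is in $O(J\,2^{2s})$, assuming exact single-qubit rotations: there is an absolute constant $C$ (independent of $n$, $s$, $J$, the sets $\mathcal S_j$ and the matrices $h_{(j)}$) such that, for a suitable $\mathrm{Had}$, the operator $\mathcal U_B$ is implemented exactly by a circuit of at most $C\,J\,2^{2s}$ elementary gates. Here the elementary gates are the exact single-qubit rotations $e^{-i\theta X/2}$, $e^{-i\theta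 Y/2}$, $e^{-i\theta Z/2}$ ($\theta\in\mathbb R$) and the controlled-nots between arbitrary pairs of qubits, and the circuit may use additional work qubits that are in the state $|0\rangle$ both before and after its application. -/

import Mathlib

open scoped Matrix.Norms.L2Operator MatrixOrder ComplexOrder

namespace BlockEnc

/-- Operators on a register of qubits labelled by `Q`, as matrices in the computational basis:
a basis state is a bit string `Q → Fin 2`, so for `Q = Fin n` these are the `2^n × 2^n` matrices. -/
abbrev Op (Q : Type) : Type := Matrix (Q → Fin 2) (Q → Fin 2) ℂ

section Embedding

variable {K Q : Type} [Fintype K] [DecidableEq K] [Fintype Q] [DecidableEq Q]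

/-- `M ⊗ I`: the operator `M` applied to the qubits `f k` (`k : K`) of the register `Q`, and the
identity on all the other qubits. -/
noncomputable def onQubits (f : K ↪ Q) (M : Op K) : Op Q :=
  Matrix.of fun x y =>
    open Classical in
    if ∀ q, q ∉ Set.range f → x q = y q then M (fun k => x (f k)) (fun k => y (f k)) else 0

end Embedding

/-! ### Elementary gates and circuits -/

/-- Elementary gates on the qubits `Q`: exact single-qubit rotations about the three axes, and
controlled-nots between arbitrary pairs of distinct qubits. -/
inductive Gate (Q : Type) : Type
  | rotX (θ : ℝ) (q : Q) : Gate Q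
  | rotY (θ : ℝ) (q : Q) : Gate Q
  | rotZ (θ : ℝ) (q : Q) : Gate Q
  | cnot (control target : Q) (h : control ≠ target) : Gate Q

/-- `exp(-i θ X / 2)` -/
noncomputable def rotXMatrix (θ : ℝ) : Matrix (Fin 2) (Fin 2) ℂ :=
  !![(Real.cos (θ / 2) : ℂ), -Complex.I * (Real.sin (θ / 2) : ℂ);
     -Complex.I * (Real.sin (θ / 2) : ℂ), (Real.cos (θ / 2) : ℂ)]

/-- `exp(-i θ Y / 2)` -/
noncomputable def rotYMatrix (θ : ℝ) : Matrix (Fin 2) (Fin 2) ℂ :=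
  !![(Real.cos (θ / 2) : ℂ), -(Real.sin (θ / 2) : ℂ);
     (Real.sin (θ / 2) : ℂ), (Real.cos (θ / 2) : ℂ)]

/-- `exp(-i θ Z / 2)` -/
noncomputable def rotZMatrix (θ : ℝ) : Matrix (Fin 2) (Fin 2) ℂ :=
  !![Complex.exp (-Complex.I * ((θ / 2 : ℝ) : ℂ)), 0;
     0, Complex.exp (Complex.I * ((θ / 2 : ℝ) : ℂ))]

section Circuits

variable {Q : Type} [Fintype Q] [DecidableEq Q]

/-- The single-qubit operator `M` applied to the qubit `q`. -/
def onQubit (q : Q) (M : Matrix (Fin 2) (Fin 2) ℂ) : Op Q :=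
  Matrix.of fun x y => if ∀ r, r ≠ q → x r = y r then M (x q) (y q) else 0

/-- `|y⟩ ↦ |y'⟩` where `y'` is `y` with the target bit replaced by `target XOR control`
(addition in `Fin 2`). -/
def cnotMatrix (control target : Q) : Op Q :=
  Matrix.of fun x y => if x = Function.update y target (y target + y control) then 1 else 0

noncomputable def Gate.matrix : Gate Q → Op Q
  | .rotX θ q => onQubit q (rotXMatrix θ)
  | .rotY θ q => onQubit q (rotYMatrix θ)
  | .rotZ θ q => onQubit q (rotZMatrix θ)
  | .cnot c t _ => cnotMatrix c t

/-- The operator of a circuit, a list of elementary gates; the head of the list is applied first.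
The gate complexity of the circuit is the length of the list. -/
noncomputable def circuitMatrix : List (Gate Q) → Op Q
  | [] => 1
  | g :: C => circuitMatrix C * g.matrix

end Circuits

section Encoding

variable {Q R W : Type} [Fintype Q] [DecidableEq Q] [Fintype R] [DecidableEq R]
  [Fintype W] [DecidableEq W]

/-- The circuit `C` on the qubits `Q` and the work qubits `W` implements the operator `U` on `Q`
exactly, the work qubits being in `|0⟩` both before and after:
`C (|y⟩ ⊗ |0⟩) = (U |y⟩) ⊗ |0⟩`. -/
def Implements (C : List (Gate (Q ⊕ W))) (U : Op Q) : Prop :=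
  ∀ (x y : Q → Fin 2) (z : W → Fin 2),
    circuitMatrix C (Sum.elim x z) (Sum.elim y fun _ => 0) = if z = 0 then U x y else 0

/-- `(⟨0^a| ⊗ I) U (|0^a⟩ ⊗ I)`, where `R` is the ancilla register. -/
def zeroBlock (U : Op (Q ⊕ R)) : Op Q :=
  Matrix.of fun x y => U (Sum.elim x fun _ => 0) (Sum.elim y fun _ => 0)

/-- The unitary `U` on the qubits `Q` and the `a` ancilla qubits `R` is an
`(α, a, ε)`-matrix-block-encoding of `A` (the norm is the operator norm). -/
def IsMatrixBlockEncoding (α : ℝ) (a : ℕ) (ε : ℝ) (U : Op (Q ⊕ R)) (A : Op Q) : Prop :=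
  Fintype.card R = a ∧ U ∈ Matrix.unitaryGroup (Q ⊕ R → Fin 2) ℂ ∧
    ‖A - (α : ℂ) • zeroBlock U‖ ≤ ε

end Encoding

/-! ### The linear combination of the dilations -/

section Dilation

variable {K : Type} [Fintype K] [DecidableEq K]

/-- The dilation `[[w, -√(1 - w²)], [√(1 - w²), w]]` of `w`, on the qubits `K` and one ancilla;
the blocks are indexed by the value of the ancilla. -/
noncomputable def dilation (w : Op K) : Op (K ⊕ Unit) :=
  let r : Op K := CFC.sqrt (1 - w * w)
  let side : (K ⊕ Unit → Fin 2) → (K → Fin 2) ⊕ (K → Fin 2) := fun x =>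
    if x (Sum.inr ()) = 0 then Sum.inl (x ∘ Sum.inl) else Sum.inr (x ∘ Sum.inl)
  (Matrix.fromBlocks w (-r) r w).submatrix side side

end Dilation

section LCU

variable {n J : ℕ}

/-- `H = h ⊗ I` acting on the qubits of `S`. -/
noncomputable def localTerm (S : Finset (Fin n)) (h : Op S) : Op (Fin n) :=
  onQubits (Function.Embedding.subtype (· ∈ S)) h

/-- The number of qubits of the control register. -/
abbrev ctrlSize (J : ℕ) : ℕ := Nat.clog 2 J

/-- The ancilla register: one qubit for the dilations, shared by all of them, and the control
register. -/
abbrev Anc (J : ℕ) : Type := Unit ⊕ Fin (ctrlSize J)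

/-- The binary encoding of the label `j` in the control register. -/
def label (j : Fin J) : Fin (ctrlSize J) → Fin 2 := fun i =>
  if (j : ℕ).testBit i then 1 else 0

def ctrlQubits (n J : ℕ) : Fin (ctrlSize J) ↪ Fin n ⊕ Anc J where
  toFun i := Sum.inr (Sum.inr i)
  inj' := fun _ _ h => Sum.inr_injective (Sum.inr_injective h)

def dilationQubits (J : ℕ) (S : Finset (Fin n)) : S ⊕ Unit ↪ Fin n ⊕ Anc J where
  toFun := Sum.map Subtype.val Sum.inl
  inj' := Function.Injective.sumMap Subtype.val_injective Sum.inl_injective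

/-- `|j⟩⟨j|` on the control register. -/
noncomputable def ctrlProj (n : ℕ) (j : Fin J) : Op (Fin n ⊕ Anc J) :=
  onQubits (ctrlQubits n J) (Matrix.single (label j) (label j) 1)

/-- `∑ⱼ |j⟩⟨j| ⊗ Uⱼ`, where `Uⱼ` is the dilation of `1 - hⱼ` applied to the qubits of `S j` and the
dilation ancilla; extended by the identity to the control states that label no `j`. -/
noncomputable def selectOp (S : Fin J → Finset (Fin n)) (h : ∀ j, Op (S j)) :
    Op (Fin n ⊕ Anc J) :=
  ∑ j, ctrlProj n j * onQubits (dilationQubits J (S j)) (dilation (1 - h j)) +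
    (1 - ∑ j, ctrlProj n j)

/-- A unitary on the control register with `Had |0⟩ = ∑ⱼ |j⟩ / √J`. -/
def IsUniformPrep (J : ℕ) (had : Op (Fin (ctrlSize J))) : Prop :=
  had ∈ Matrix.unitaryGroup (Fin (ctrlSize J) → Fin 2) ℂ ∧
    had.mulVec (Pi.single 0 1) = ∑ j : Fin J, ((1 / Real.sqrt J : ℝ) : ℂ) • Pi.single (label j) 1

/-- `(Hadᴴ ⊗ 1) Select (Had ⊗ 1)`. -/
noncomputable def lcuOp (had : Op (Fin (ctrlSize J))) (S : Fin J → Finset (Fin n))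
    (h : ∀ j, Op (S j)) : Op (Fin n ⊕ Anc J) :=
  onQubits (ctrlQubits n J) had.conjTranspose * selectOp S h * onQubits (ctrlQubits n J) had

end LCU

end BlockEnc

/-!
In an eigenbasis of `w = cos θ`, the dilation of `w` rotates the ancilla about the `Y` axis by twice
the eigenangle of the state of the other qubits. It is therefore a product of `2 ^ |S|` rotations,
each affecting a single eigenvector, and conjugation by a circuit preparing this eigenvector turns
such a rotation into one controlled by the zero state of the other qubits. State preparation, by
uniformly controlled rotations, costs `O(2 ^ |S|)` gates, whence the factor `2 ^ (2 * s)`.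

Controlling every gate of the `J` dilations by the full label `j` would cost a factor `log J`.
Instead, work qubits hold the partial conjunctions of the tests on the bits of the label, and those
for different labels are shared along a binary tree, so that each label costs only `O(1)` extra
gates.
-/

namespace BlockEnc

open Matrix

open scoped Kronecker

/-! ### Operators on part of a register -/

section OnQubits

variable {K L Q : Type} [Fintype K] [Fintype Q] [DecidableEq Q]

theorem onQubits_apply (f : K ↪ Q) (M : Op K) (x y : Q → Fin 2)
    [Decidable (Set.EqOn x y (Set.range f)ᶜ)] :
    onQubits f M x y = if Set.EqOn x y (Set.range f)ᶜ then M (x ∘ f) (y ∘ f) else 0 := by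
  simp only [onQubits, of_apply]
  congr 1

open Classical in
/-- A basis state as the pair of its bits at the qubits `f k` and its bits at the other qubits. -/
noncomputable def splitBits (f : K ↪ Q) :
    (Q → Fin 2) ≃ (K → Fin 2) × ({q // q ∉ Set.range f} → Fin 2) :=
  (Equiv.piEquivPiSubtypeProd (· ∈ Set.range f) fun _ => Fin 2).trans
    (((Equiv.ofInjective f f.injective).arrowCongr (Equiv.refl _)).symm.prodCongr (Equiv.refl _))

open Classical in
theorem onQubits_eq_submatrix_kronecker (f : K ↪ Q) (M : Op K) :
    onQubits f M = (M ⊗ₖ 1).submatrix (splitBits f) (splitBits f) := by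
  ext x y
  have h : Set.EqOn x y (Set.range f)ᶜ ↔ (splitBits f x).2 = (splitBits f y).2 := by
    simp [splitBits, Set.EqOn, funext_iff, Equiv.piEquivPiSubtypeProd]
  simp only [onQubits_apply, submatrix_apply, kroneckerMap_apply, one_apply, mul_ite, mul_one,
    mul_zero, h]
  rfl

/-- `M ↦ M ⊗ I` as a homomorphism of star algebras. -/
noncomputable def onQubitsHom [DecidableEq K] (f : K ↪ Q) : Op K →⋆ₐ[ℂ] Op Q where
  toFun := onQubits f
  map_one' := by
    classical
    simp [onQubits_eq_submatrix_kronecker]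
  map_mul' M N := by
    classical
    simp [onQubits_eq_submatrix_kronecker, ← mul_kronecker_mul]
  map_zero' := by
    classical
    simp [onQubits_eq_submatrix_kronecker]
  map_add' M N := by
    classical
    simp only [onQubits_eq_submatrix_kronecker, add_kronecker]
    rfl
  commutes' c := by
    classical
    simp only [onQubits_eq_submatrix_kronecker, Algebra.algebraMap_eq_smul_one, smul_kronecker,
      one_kronecker_one, submatrix_smul, Pi.smul_apply, submatrix_one_equiv]
  map_star' M := by
    classical
    simp [onQubits_eq_submatrix_kronecker, star_eq_conjTranspose, conjTranspose_kronecker]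

variable (f : K ↪ Q)

theorem onQubits_one : onQubits f 1 = 1 := by
  classical exact map_one (onQubitsHom f)

theorem onQubits_mul [DecidableEq K] (M N : Op K) :
    onQubits f (M * N) = onQubits f M * onQubits f N :=
  map_mul (onQubitsHom f) M N

theorem onQubits_sub (M N : Op K) : onQubits f (M - N) = onQubits f M - onQubits f N := by
  classical exact map_sub (onQubitsHom f) M N

theorem onQubits_smul (c : ℂ) (M : Op K) : onQubits f (c • M) = c • onQubits f M := by
  classical exact map_smul (onQubitsHom f) c M

theorem onQubits_conjTranspose (M : Op K) : onQubits f Mᴴ = (onQubits f M)ᴴ := by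
  classical exact map_star (onQubitsHom f) M

theorem onQubits_mem_unitaryGroup [DecidableEq K] {M : Op K} (hM : M ∈ unitaryGroup (K → Fin 2) ℂ) :
    onQubits f M ∈ unitaryGroup (Q → Fin 2) ℂ :=
  Unitary.map_mem (onQubitsHom f) hM

theorem onQubits_onQubits [Fintype L] [DecidableEq K] (g : L ↪ K) (M : Op L) :
    onQubits f (onQubits g M) = onQubits (g.trans f) M := by
  classical
  ext x y
  simp only [onQubits_apply, ← ite_and]
  refine if_congr ?_ rfl rfl
  simp only [Set.EqOn, Set.mem_compl_iff, Set.mem_range, not_exists, Function.comp_apply,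
    Function.Embedding.trans_apply]
  refine ⟨fun h q hq => ?_, fun h =>
    ⟨fun q hq => h fun l => hq (g l), fun k hk => h fun l hl => hk l (f.injective hl)⟩⟩
  by_cases hqf : ∃ k, f k = q
  · obtain ⟨k, rfl⟩ := hqf
    exact h.2 fun l hl => hq l (congrArg f hl)
  · exact h.1 fun k hk => hqf ⟨k, hk⟩

theorem onQubits_single_self_mul_apply {ι : Type*} (u : K → Fin 2) (A : Matrix (Q → Fin 2) ι ℂ)
    (x : Q → Fin 2) (i : ι) [Decidable (x ∘ f = u)] :
    (onQubits f (single u u 1) * A) x i = if x ∘ f = u then A x i else 0 := by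
  classical
  have h : onQubits f (single u u 1) = diagonal fun x => if x ∘ f = u then 1 else 0 := by
    ext x y
    by_cases hxy : x = y
    · subst hxy
      simp [onQubits_apply, single_apply, eq_comm, Set.eqOn_refl]
    · simp only [onQubits_apply, single_apply, diagonal_apply_ne _ hxy, ite_eq_right_iff]
      rintro h ⟨hx, hy⟩
      refine absurd (funext fun q => ?_) hxy
      by_cases hq : q ∈ Set.range f
      · obtain ⟨k, rfl⟩ := hq
        exact congrFun (hx.symm.trans hy) k
      · exact h hq
  simp [h, diagonal_mul]

end OnQubits

section OnQubit

variable {K Q : Type} [Fintype Q] [DecidableEq Q]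

theorem onQubit_eq_onQubits (q : Q) (M : Matrix (Fin 2) (Fin 2) ℂ) :
    onQubit q M = onQubits (.punit q)
      (M.submatrix (Equiv.funUnique Unit (Fin 2)) (Equiv.funUnique Unit (Fin 2))) := by
  classical
  ext x y
  rw [onQubits_apply, onQubit, of_apply]
  exact if_congr (forall_congr' fun r => by simp [Function.Embedding.punit, eq_comm]) rfl rfl

theorem onQubits_onQubit [Fintype K] [DecidableEq K] (f : K ↪ Q) (k : K)
    (M : Matrix (Fin 2) (Fin 2) ℂ) : onQubits f (onQubit k M) = onQubit (f k) M := by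
  rw [onQubit_eq_onQubits, onQubits_onQubits, onQubit_eq_onQubits]
  rfl

variable (q : Q)

theorem onQubit_one : onQubit q 1 = 1 := by
  rw [onQubit_eq_onQubits, submatrix_one_equiv, onQubits_one]

theorem onQubit_mul (M N : Matrix (Fin 2) (Fin 2) ℂ) :
    onQubit q (M * N) = onQubit q M * onQubit q N := by
  simp only [onQubit_eq_onQubits, ← onQubits_mul, submatrix_mul_equiv]

theorem onQubit_conjTranspose (M : Matrix (Fin 2) (Fin 2) ℂ) :
    onQubit q Mᴴ = (onQubit q M)ᴴ := by
  simp only [onQubit_eq_onQubits, ← onQubits_conjTranspose, conjTranspose_submatrix]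

theorem onQubit_mulVec_apply (M : Matrix (Fin 2) (Fin 2) ℂ) (v : (Q → Fin 2) → ℂ)
    (x : Q → Fin 2) : (onQubit q M *ᵥ v) x = ∑ b, M (x q) b * v (Function.update x q b) := by
  have h : ∀ y, onQubit q M x y = ∑ b, if Function.update x q b = y then M (x q) b else 0 := by
    intro y
    simp_rw [Function.update_eq_iff, ite_and, Finset.sum_ite_eq', onQubit]
    simp
  simp_rw [mulVec, dotProduct, h, Finset.sum_mul, ite_mul, zero_mul]
  rw [Finset.sum_comm]
  simp only [Finset.sum_ite_eq, Finset.mem_univ, if_true]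

end OnQubit

/-! ### Multiplexed operators -/

section Multiplex

variable {K Q : Type} {s : Set Q} {V V' : (Q → Fin 2) → Op Q}

/-- The operator `M` is diagonal in the qubits of `s`, which can therefore serve as controls
for `M`. -/
def PreservesQubits (s : Set Q) (M : Op Q) : Prop :=
  ∀ ⦃x y⦄, M x y ≠ 0 → Set.EqOn x y s

/-- The operator whose row at the basis state `x` is that of `V x`. If `V x` depends only on qubits
that all the operators `V y` preserve, then `multiplex V` applies `V x` under the control of
these qubits. -/
def multiplex (V : (Q → Fin 2) → Op Q) : Op Q := of fun x y => V x x y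

theorem PreservesQubits.apply_eq_zero {M : Op Q} (hM : PreservesQubits s M) {x y : Q → Fin 2}
    (h : ¬Set.EqOn x y s) : M x y = 0 :=
  by_contra fun h0 => h (hM h0)

theorem multiplex_apply_right (hV : ∀ x, PreservesQubits s (V x)) (hVs : DependsOn V s)
    (x y : Q → Fin 2) : multiplex V x y = V y x y := by
  by_cases h : Set.EqOn x y s
  · rw [multiplex, of_apply, hVs h]
  · rw [multiplex, of_apply, (hV x).apply_eq_zero h, (hV y).apply_eq_zero h]

theorem multiplex_conjTranspose (hV : ∀ x, PreservesQubits s (V x)) (hVs : DependsOn V s) :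
    (multiplex V)ᴴ = multiplex fun x => (V x)ᴴ := by
  ext x y
  rw [conjTranspose_apply, multiplex_apply_right hV hVs]
  rfl

theorem dependsOn_comp_range {α : Type*} (f : K → Q) (F : (K → Fin 2) → α) :
    DependsOn (fun x => F (x ∘ f)) (Set.range f) := fun _ _ h =>
  congrArg F (funext fun k => h _ (Set.mem_range_self k))

variable [Fintype Q]

theorem preservesQubits_one : PreservesQubits s (1 : Op Q) := fun x y h => by
  rw [not_imp_comm.1 one_apply_ne h]
  exact Set.eqOn_refl y s

variable [DecidableEq Q]

theorem preservesQubits_onQubits [Fintype K] {f : K ↪ Q}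
    (hs : Disjoint s (Set.range f)) (M : Op K) : PreservesQubits s (onQubits f M) := fun x y h => by
  classical
  rw [onQubits_apply, ite_ne_right_iff] at h
  exact h.1.mono hs.subset_compl_right

theorem preservesQubits_onQubit {t : Q} (ht : t ∉ s) (M : Matrix (Fin 2) (Fin 2) ℂ) :
    PreservesQubits s (onQubit t M) := by
  rw [onQubit_eq_onQubits]
  refine preservesQubits_onQubits (Set.disjoint_right.2 ?_) _
  rintro _ ⟨_, rfl⟩
  exact ht

theorem multiplex_mulVec_apply (v : (Q → Fin 2) → ℂ) (x : Q → Fin 2) :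
    (multiplex V *ᵥ v) x = (V x *ᵥ v) x := rfl

theorem multiplex_mul (hV : ∀ x, PreservesQubits s (V x)) (hV' : DependsOn V' s) :
    multiplex V * multiplex V' = multiplex fun x => V x * V' x := by
  ext x y
  simp only [multiplex, mul_apply, of_apply]
  refine Finset.sum_congr rfl fun z _ => ?_
  by_cases h : Set.EqOn x z s
  · rw [hV' h]
  · rw [(hV x).apply_eq_zero h, zero_mul, zero_mul]

theorem multiplex_mem_unitaryGroup (hV : ∀ x, PreservesQubits s (V x)) (hVs : DependsOn V s)
    (hVu : ∀ x, V x ∈ unitaryGroup (Q → Fin 2) ℂ) :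
    multiplex V ∈ unitaryGroup (Q → Fin 2) ℂ := by
  rw [mem_unitaryGroup_iff, star_eq_conjTranspose, multiplex_conjTranspose hV hVs,
    multiplex_mul hV fun x y h => by rw [hVs h]]
  ext x y
  rw [multiplex, of_apply, ← star_eq_conjTranspose, mem_unitaryGroup_iff.1 (hVu x)]

theorem onQubits_multiplex [Fintype K] (f : K ↪ Q) (V : (K → Fin 2) → Op K) :
    onQubits f (multiplex V) = multiplex fun x => onQubits f (V (x ∘ f)) := by
  classical
  ext x y
  simp [multiplex, onQubits_apply]

end Multiplex

section Controlled

variable {Q : Type} [Fintype Q] {c : Q} {U V M N : Op Q}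

/-- The operator `U` controlled by the qubit `c`, provided that `U` preserves `c`. -/
def controlled (c : Q) (U : Op Q) : Op Q := multiplex fun x => if x c = 1 then U else 1

theorem controlled_one (c : Q) : controlled c 1 = 1 := by
  simp only [controlled, ite_self]
  rfl

variable [DecidableEq Q]

theorem mul_controlled_mul (hM : PreservesQubits {c} M) (hU : PreservesQubits {c} U)
    (hMN : M * N = 1) : M * controlled c U * N = controlled c (M * U * N) := by
  have hctrl : ∀ x : Q → Fin 2, PreservesQubits {c} (if x c = 1 then U else 1) := fun x => by
    split_ifs
    exacts [hU, preservesQubits_one]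
  unfold controlled
  change multiplex (fun _ => M) * _ * multiplex (fun _ => N) = _
  rw [mul_assoc, multiplex_mul hctrl fun _ _ _ => rfl,
    multiplex_mul (fun _ => hM) fun x y h => by rw [h c rfl]]
  refine congrArg multiplex (funext fun x => ?_)
  split_ifs
  · rw [mul_assoc]
  · rw [one_mul, hMN]

theorem controlled_mul (hU : PreservesQubits {c} U) :
    controlled c U * controlled c V = controlled c (U * V) := by
  unfold controlled
  rw [multiplex_mul (s := {c}) ?_ fun x y h => by rw [h c rfl]]
  · refine congrArg multiplex (funext fun x => ?_)
    split_ifs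
    exacts [rfl, one_mul 1]
  · intro x
    split_ifs
    exacts [hU, preservesQubits_one]

end Controlled

/-! ### Gates and circuits -/

section Rotations

theorem rotXMatrix_conjTranspose (θ : ℝ) : (rotXMatrix θ)ᴴ = rotXMatrix (-θ) := by
  ext i j
  fin_cases i <;> fin_cases j <;>
    simp [rotXMatrix, neg_div, -Complex.ofReal_cos, -Complex.ofReal_sin, -Complex.ofReal_div]

theorem rotYMatrix_conjTranspose (θ : ℝ) : (rotYMatrix θ)ᴴ = rotYMatrix (-θ) := by
  ext i j
  fin_cases i <;> fin_cases j <;>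
    simp [rotYMatrix, neg_div, -Complex.ofReal_cos, -Complex.ofReal_sin, -Complex.ofReal_div]

theorem rotZMatrix_conjTranspose (θ : ℝ) : (rotZMatrix θ)ᴴ = rotZMatrix (-θ) := by
  ext i j
  fin_cases i <;> fin_cases j <;>
    simp [rotZMatrix, neg_div, ← Complex.exp_conj, Complex.conj_ofNat]

theorem rotXMatrix_mul (θ φ : ℝ) : rotXMatrix θ * rotXMatrix φ = rotXMatrix (θ + φ) := by
  ext i j
  fin_cases i <;> fin_cases j <;>
    simp [rotXMatrix, mul_apply, Fin.sum_univ_two, add_div, Complex.cos_add, Complex.sin_add] <;>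
    ring_nf <;> simp only [Complex.I_sq] <;> ring

theorem rotYMatrix_mul (θ φ : ℝ) : rotYMatrix θ * rotYMatrix φ = rotYMatrix (θ + φ) := by
  ext i j
  fin_cases i <;> fin_cases j <;>
    simp [rotYMatrix, mul_apply, Fin.sum_univ_two, add_div, Complex.cos_add, Complex.sin_add] <;>
    ring

theorem rotZMatrix_mul (θ φ : ℝ) : rotZMatrix θ * rotZMatrix φ = rotZMatrix (θ + φ) := by
  ext i j
  fin_cases i <;> fin_cases j <;>
    simp [rotZMatrix, mul_apply, Fin.sum_univ_two, ← Complex.exp_add] <;>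
    ring_nf

theorem rotXMatrix_zero : rotXMatrix 0 = 1 := by simp [rotXMatrix, one_fin_two]

theorem rotYMatrix_zero : rotYMatrix 0 = 1 := by simp [rotYMatrix, one_fin_two]

theorem rotZMatrix_zero : rotZMatrix 0 = 1 := by simp [rotZMatrix, one_fin_two]

theorem rotXMatrix_mem_unitaryGroup (θ : ℝ) : rotXMatrix θ ∈ unitaryGroup (Fin 2) ℂ := by
  rw [mem_unitaryGroup_iff, star_eq_conjTranspose, rotXMatrix_conjTranspose, rotXMatrix_mul,
    add_neg_cancel, rotXMatrix_zero]

theorem rotYMatrix_mem_unitaryGroup (θ : ℝ) : rotYMatrix θ ∈ unitaryGroup (Fin 2) ℂ := by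
  rw [mem_unitaryGroup_iff, star_eq_conjTranspose, rotYMatrix_conjTranspose, rotYMatrix_mul,
    add_neg_cancel, rotYMatrix_zero]

theorem rotZMatrix_mem_unitaryGroup (θ : ℝ) : rotZMatrix θ ∈ unitaryGroup (Fin 2) ℂ := by
  rw [mem_unitaryGroup_iff, star_eq_conjTranspose, rotZMatrix_conjTranspose, rotZMatrix_mul,
    add_neg_cancel, rotZMatrix_zero]

/-- The bit flip `X`. -/
def notMatrix : Matrix (Fin 2) (Fin 2) ℂ := !![0, 1; 1, 0]

theorem notMatrix_conjTranspose : notMatrixᴴ = notMatrix := by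
  ext i j
  fin_cases i <;> fin_cases j <;> simp [notMatrix]

theorem notMatrix_mem_unitaryGroup : notMatrix ∈ unitaryGroup (Fin 2) ℂ := by
  rw [mem_unitaryGroup_iff, star_eq_conjTranspose, notMatrix_conjTranspose]
  simp [notMatrix, one_fin_two]

theorem notMatrix_mul_rotYMatrix_mul_notMatrix (θ : ℝ) :
    notMatrix * rotYMatrix θ * notMatrix = rotYMatrix (-θ) := by
  simp [rotYMatrix, notMatrix, neg_div]

theorem notMatrix_mul_rotZMatrix_mul_notMatrix (θ : ℝ) :
    notMatrix * rotZMatrix θ * notMatrix = rotZMatrix (-θ) := by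
  simp [rotZMatrix, notMatrix, neg_div]

end Rotations

section Gates

variable {K Q : Type} [Fintype Q] [DecidableEq Q]

theorem onQubit_mem_unitaryGroup (q : Q) {M : Matrix (Fin 2) (Fin 2) ℂ}
    (hM : M ∈ unitaryGroup (Fin 2) ℂ) : onQubit q M ∈ unitaryGroup (Q → Fin 2) ℂ := by
  rw [mem_unitaryGroup_iff, star_eq_conjTranspose, ← onQubit_conjTranspose, ← onQubit_mul,
    ← star_eq_conjTranspose, mem_unitaryGroup_iff.1 hM, onQubit_one]

theorem onQubit_notMatrix_apply (t : Q) (x y : Q → Fin 2) :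
    onQubit t notMatrix x y = if x = Function.update y t (y t + 1) then 1 else 0 := by
  have h : ∀ a b : Fin 2, notMatrix a b = if a = b + 1 then 1 else 0 := by
    intro a b
    fin_cases a <;> fin_cases b <;> simp [notMatrix]
  rw [onQubit, of_apply, h, ← ite_and]
  exact if_congr (by rw [Function.eq_update_iff, and_comm]) rfl rfl

theorem cnotMatrix_eq_multiplex {c t : Q} (h : c ≠ t) :
    cnotMatrix c t = multiplex fun x => onQubit t (if x c = 1 then notMatrix else 1) := by
  ext x y
  rw [multiplex_apply_right (s := {c})
    (fun x => preservesQubits_onQubit (Set.notMem_singleton_iff.2 h.symm) _)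
    fun x y hxy => by rw [hxy c rfl]]
  obtain hy | hy : y c = 0 ∨ y c = 1 := by omega
  · simp [hy, cnotMatrix, onQubit_one, one_apply]
  · simp [hy, cnotMatrix, onQubit_notMatrix_apply]

theorem cnotMatrix_conjTranspose {c t : Q} (h : c ≠ t) : (cnotMatrix c t)ᴴ = cnotMatrix c t := by
  rw [cnotMatrix_eq_multiplex h, multiplex_conjTranspose (s := {c})
    (fun x => preservesQubits_onQubit (Set.notMem_singleton_iff.2 h.symm) _)
    fun x y hxy => by rw [hxy c rfl]]
  simp only [← onQubit_conjTranspose, apply_ite conjTranspose, notMatrix_conjTranspose,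
    conjTranspose_one]

/-- The inverse gate. -/
def Gate.inv : Gate Q → Gate Q
  | .rotX θ q => .rotX (-θ) q
  | .rotY θ q => .rotY (-θ) q
  | .rotZ θ q => .rotZ (-θ) q
  | .cnot c t h => .cnot c t h

theorem Gate.matrix_inv (g : Gate Q) : g.inv.matrix = g.matrixᴴ := by
  cases g with
  | rotX θ q => rw [inv, matrix, matrix, ← onQubit_conjTranspose, rotXMatrix_conjTranspose]
  | rotY θ q => rw [inv, matrix, matrix, ← onQubit_conjTranspose, rotYMatrix_conjTranspose]
  | rotZ θ q => rw [inv, matrix, matrix, ← onQubit_conjTranspose, rotZMatrix_conjTranspose]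
  | cnot c t h => exact (cnotMatrix_conjTranspose h).symm

theorem Gate.matrix_mem_unitaryGroup (g : Gate Q) :
    g.matrix ∈ unitaryGroup (Q → Fin 2) ℂ := by
  cases g with
  | rotX θ q => exact onQubit_mem_unitaryGroup q (rotXMatrix_mem_unitaryGroup θ)
  | rotY θ q => exact onQubit_mem_unitaryGroup q (rotYMatrix_mem_unitaryGroup θ)
  | rotZ θ q => exact onQubit_mem_unitaryGroup q (rotZMatrix_mem_unitaryGroup θ)
  | cnot c t h =>
    rw [matrix, cnotMatrix_eq_multiplex h]
    refine multiplex_mem_unitaryGroup (s := {c})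
      (fun x => preservesQubits_onQubit (Set.notMem_singleton_iff.2 h.symm) _)
      (fun x y hxy => by rw [hxy c rfl]) fun x => onQubit_mem_unitaryGroup t ?_
    split_ifs
    exacts [notMatrix_mem_unitaryGroup, one_mem _]

/-- The gate with its qubits relabelled along an embedding. -/
def Gate.map (f : K ↪ Q) : Gate K → Gate Q
  | .rotX θ q => .rotX θ (f q)
  | .rotY θ q => .rotY θ (f q)
  | .rotZ θ q => .rotZ θ (f q)
  | .cnot c t h => .cnot (f c) (f t) (f.injective.ne h)

theorem Gate.matrix_map [Fintype K] [DecidableEq K] (f : K ↪ Q) (g : Gate K) :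
    (g.map f).matrix = onQubits f g.matrix := by
  cases g with
  | cnot c t h =>
    simp only [map, matrix, cnotMatrix_eq_multiplex h, cnotMatrix_eq_multiplex (f.injective.ne h),
      onQubits_multiplex, onQubits_onQubit, Function.comp_apply]
  | _ => simp only [map, matrix, onQubits_onQubit]

end Gates

section Circuits

variable {K Q : Type}

/-- The inverse circuit. -/
def invCircuit (C : List (Gate Q)) : List (Gate Q) := (C.map Gate.inv).reverse

theorem length_invCircuit (C : List (Gate Q)) : (invCircuit C).length = C.length := by
  simp only [invCircuit, List.length_reverse, List.length_map]

variable [Fintype Q] [DecidableEq Q]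

theorem circuitMatrix_append (C D : List (Gate Q)) :
    circuitMatrix (C ++ D) = circuitMatrix D * circuitMatrix C := by
  induction C with
  | nil => simp only [circuitMatrix, List.nil_append, mul_one]
  | cons g C ih => simp only [circuitMatrix, List.cons_append, ih, mul_assoc]

theorem circuitMatrix_singleton (g : Gate Q) : circuitMatrix [g] = g.matrix :=
  one_mul g.matrix

theorem circuitMatrix_map [Fintype K] [DecidableEq K] (f : K ↪ Q) (C : List (Gate K)) :
    circuitMatrix (C.map (Gate.map f)) = onQubits f (circuitMatrix C) := by
  induction C with
  | nil => exact (onQubits_one f).symm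
  | cons g C ih => simp only [circuitMatrix, List.map_cons, ih, onQubits_mul, Gate.matrix_map]

theorem circuitMatrix_mem_unitaryGroup (C : List (Gate Q)) :
    circuitMatrix C ∈ unitaryGroup (Q → Fin 2) ℂ := by
  induction C with
  | nil => exact one_mem _
  | cons g C ih => exact mul_mem ih g.matrix_mem_unitaryGroup

theorem circuitMatrix_invCircuit (C : List (Gate Q)) :
    circuitMatrix (invCircuit C) = (circuitMatrix C)ᴴ := by
  induction C with
  | nil => exact conjTranspose_one.symm
  | cons g C ih =>
    rw [invCircuit, List.map_cons, List.reverse_cons, circuitMatrix_append, ← invCircuit, ih,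
      circuitMatrix_singleton, Gate.matrix_inv, circuitMatrix, conjTranspose_mul]

end Circuits

/-! ### Uniformly controlled rotations -/

section UniformlyControlled

variable {Q : Type} [DecidableEq Q]

theorem dependsOn_comp_update {α : Type*} {f : (Q → Fin 2) → α} {d : Q} {D : Set Q}
    (hf : DependsOn f (insert d D)) (b : Fin 2) :
    DependsOn (fun x => f (Function.update x d b)) D := fun x y hxy => hf fun q hq => by
  obtain rfl | hqd := eq_or_ne q d
  · simp
  · simpa [hqd] using hxy q (Set.mem_of_mem_insert_of_ne hq hqd)

variable [Fintype Q]

section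

variable {t : Q} {R : ℝ → Matrix (Fin 2) (Fin 2) ℂ} (hadd : ∀ θ φ, R θ * R φ = R (θ + φ))
  (hnot : ∀ θ, notMatrix * R θ * notMatrix = R (-θ))

include hadd hnot

theorem cnotMatrix_mul_multiplex_mul_cnotMatrix_mul_multiplex {c : Q} (h : c ≠ t)
    {α β : (Q → Fin 2) → ℝ} (hα : DependsOn α {t}ᶜ) (hβ : DependsOn β {t}ᶜ) :
    cnotMatrix c t * multiplex (fun x => onQubit t (R (β x))) * cnotMatrix c t *
        multiplex (fun x => onQubit t (R (α x))) =
      multiplex fun x => onQubit t (R (if x c = 1 then α x - β x else α x + β x)) := by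
  have hmul {M N : (Q → Fin 2) → Matrix (Fin 2) (Fin 2) ℂ} (hN : DependsOn N {t}ᶜ) :
      multiplex (fun x => onQubit t (M x)) * multiplex (fun x => onQubit t (N x)) =
        multiplex fun x => onQubit t (M x * N x) := by
    simp only [onQubit_mul]
    exact multiplex_mul (s := {t}ᶜ) (fun x => preservesQubits_onQubit (by simp) _)
      fun x y hxy => by rw [hN hxy]
  rw [cnotMatrix_eq_multiplex h, hmul fun x y hxy => by rw [hβ hxy],
    hmul fun x y hxy => by rw [hxy c h], hmul fun x y hxy => by rw [hα hxy]]
  congr! 3 with x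
  split_ifs
  · rw [hnot, hadd, neg_add_eq_sub]
  · rw [one_mul, mul_one, hadd, add_comm]

theorem exists_circuit_multiplex_rotation (hgate : ∀ θ, ∃ g : Gate Q, g.matrix = onQubit t (R θ))
    {D : Finset Q} (ht : t ∉ D) {θ : (Q → Fin 2) → ℝ} (hθ : DependsOn θ D) :
    ∃ C : List (Gate Q), circuitMatrix C = multiplex (fun x => onQubit t (R (θ x))) ∧
      C.length + 2 ≤ 3 * 2 ^ D.card := by
  induction D using Finset.induction_on generalizing θ with
  | empty =>
    obtain ⟨g, hg⟩ := hgate (θ 0)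
    refine ⟨[g], ?_, le_rfl⟩
    ext x y
    rw [circuitMatrix_singleton, hg, multiplex, of_apply, hθ fun i hi => absurd hi (by simp)]
  | insert d D hd ih =>
    obtain ⟨htd, htD⟩ : t ≠ d ∧ t ∉ D := by rwa [Finset.mem_insert, not_or] at ht
    rw [Finset.coe_insert] at hθ
    have hθd := dependsOn_comp_update hθ
    have hDt : (D : Set Q) ⊆ {t}ᶜ := Set.subset_compl_singleton_iff.2 htD
    let halfSum (x : Q → Fin 2) : ℝ :=
      (θ (Function.update x d 0) + θ (Function.update x d 1)) / 2
    let halfDiff (x : Q → Fin 2) : ℝ :=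
      (θ (Function.update x d 0) - θ (Function.update x d 1)) / 2
    have hsum : DependsOn halfSum D := fun x y h => by simp only [halfSum, hθd 0 h, hθd 1 h]
    have hdiff : DependsOn halfDiff D := fun x y h => by simp only [halfDiff, hθd 0 h, hθd 1 h]
    obtain ⟨A, hA, hAl⟩ := ih htD hsum
    obtain ⟨B, hB, hBl⟩ := ih htD hdiff
    refine ⟨A ++ ([.cnot d t htd.symm] ++ (B ++ [.cnot d t htd.symm])), ?_, ?_⟩
    · simp only [circuitMatrix_append, circuitMatrix_singleton, hA, hB, Gate.matrix]
      rw [cnotMatrix_mul_multiplex_mul_cnotMatrix_mul_multiplex hadd hnot htd.symm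
        (hsum.mono hDt) (hdiff.mono hDt)]
      congr! 4 with x
      have hx : Function.update x d (x d) = x := Function.update_eq_self d x
      obtain h | h : x d = 0 ∨ x d = 1 := by omega
      all_goals
        rw [h] at hx
        simp [h, halfSum, halfDiff, hx]
        ring
    · rw [Finset.card_insert_of_notMem hd, pow_succ]
      simp only [List.length_append, List.length_singleton]
      omega

end

variable {t : Q} {D : Finset Q} {θ : (Q → Fin 2) → ℝ}

theorem exists_circuit_multiplex_rotY (ht : t ∉ D) (hθ : DependsOn θ D) :
    ∃ C : List (Gate Q), circuitMatrix C = multiplex (fun x => onQubit t (rotYMatrix (θ x))) ∧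
      C.length ≤ 3 * 2 ^ D.card := by
  obtain ⟨C, hC, hl⟩ := exists_circuit_multiplex_rotation rotYMatrix_mul
    notMatrix_mul_rotYMatrix_mul_notMatrix (fun θ => ⟨.rotY θ t, rfl⟩) ht hθ
  exact ⟨C, hC, by omega⟩

theorem exists_circuit_multiplex_rotZ (ht : t ∉ D) (hθ : DependsOn θ D) :
    ∃ C : List (Gate Q), circuitMatrix C = multiplex (fun x => onQubit t (rotZMatrix (θ x))) ∧
      C.length ≤ 3 * 2 ^ D.card := by
  obtain ⟨C, hC, hl⟩ := exists_circuit_multiplex_rotation rotZMatrix_mul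
    notMatrix_mul_rotZMatrix_mul_notMatrix (fun θ => ⟨.rotZ θ t, rfl⟩) ht hθ
  exact ⟨C, hC, by omega⟩

theorem rotYMatrix_ite_pi_apply_zero (p : Prop) [Decidable p] (b : Fin 2) :
    rotYMatrix (if p then Real.pi else 0) b 0 = if b = (if p then 1 else 0) then 1 else 0 := by
  split_ifs <;> fin_cases b <;> simp_all [rotYMatrix]

/-- The rotation by `π` flips a qubit in the state `|0⟩` with no phase, so that its uniformly
controlled version writes the value of a predicate into a clean qubit. -/
theorem exists_circuit_compute {c : Q} (hc : c ∉ D) {P : (Q → Fin 2) → Prop} [DecidablePred P]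
    (hP : DependsOn P D) :
    ∃ C : List (Gate Q), C.length ≤ 3 * 2 ^ D.card ∧ ∀ x y, y c = 0 →
      circuitMatrix C x y = if x = Function.update y c (if P y then 1 else 0) then 1 else 0 := by
  obtain ⟨C, hC, hl⟩ := exists_circuit_multiplex_rotY hc
    (θ := fun x => if P x then Real.pi else 0) fun x y hxy => by simp only [hP hxy]
  refine ⟨C, hl, fun x y hy => ?_⟩
  have hpres : ∀ x, PreservesQubits D (onQubit c (rotYMatrix (if P x then Real.pi else 0))) :=
    fun x => preservesQubits_onQubit hc _
  rw [hC, multiplex_apply_right hpres fun x y hxy => by simp only [hP hxy]]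
  rw [onQubit, of_apply, hy, rotYMatrix_ite_pi_apply_zero, ← ite_and]
  exact if_congr (by rw [Function.eq_update_iff, and_comm]) rfl rfl

end UniformlyControlled

/-! ### State preparation -/

section StatePreparation

variable {Q : Type} [Fintype Q] [DecidableEq Q]

theorem exists_rotZ_mul_rotY (a : Fin 2 → ℂ) :
    ∃ (r : ℂ) (θ φ : ℝ), ∀ i, a i = (rotZMatrix φ * rotYMatrix θ) i 0 * r := by
  let z : ℂ := ⟨‖a 0‖, ‖a 1‖⟩
  have hcos : (‖a 0‖ : ℂ) = ‖z‖ * Complex.cos z.arg := by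
    rw [← Complex.ofReal_cos, ← Complex.ofReal_mul, Complex.norm_mul_cos_arg]
  have hsin : (‖a 1‖ : ℂ) = ‖z‖ * Complex.sin z.arg := by
    rw [← Complex.ofReal_sin, ← Complex.ofReal_mul, Complex.norm_mul_sin_arg]
  refine ⟨‖z‖ * Complex.exp (((a 0).arg + (a 1).arg) / 2 * Complex.I), 2 * z.arg,
    (a 1).arg - (a 0).arg, Fin.forall_fin_two.2 ⟨?_, ?_⟩⟩
  · have hexp : Complex.exp ((a 0).arg * Complex.I) =
        Complex.exp (-(Complex.I * (((a 1).arg - (a 0).arg) / 2))) *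
          Complex.exp (((a 0).arg + (a 1).arg) / 2 * Complex.I) := by
      rw [← Complex.exp_add]
      ring_nf
    have hpolar := Complex.norm_mul_exp_arg_mul_I (a 0)
    rw [hcos, hexp] at hpolar
    simp [rotZMatrix, rotYMatrix, mul_apply, Fin.sum_univ_two]
    linear_combination -hpolar
  · have hexp : Complex.exp ((a 1).arg * Complex.I) =
        Complex.exp (Complex.I * (((a 1).arg - (a 0).arg) / 2)) *
          Complex.exp (((a 0).arg + (a 1).arg) / 2 * Complex.I) := by
      rw [← Complex.exp_add]
      ring_nf
    have hpolar := Complex.norm_mul_exp_arg_mul_I (a 1)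
    rw [hsin, hexp] at hpolar
    simp [rotZMatrix, rotYMatrix, mul_apply, Fin.sum_univ_two]
    linear_combination -hpolar

theorem exists_eq_multiplex_mulVec {D : Finset Q} {d : Q} (hd : d ∉ D) {v : (Q → Fin 2) → ℂ}
    (hv : ∀ x, v x ≠ 0 → Set.EqOn x 0 (insert d D : Set Q)ᶜ) :
    ∃ (u : (Q → Fin 2) → ℂ) (θ φ : (Q → Fin 2) → ℝ),
      (∀ x, u x ≠ 0 → Set.EqOn x 0 (D : Set Q)ᶜ) ∧ DependsOn θ D ∧ DependsOn φ D ∧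
      v = multiplex (fun x => onQubit d (rotZMatrix (φ x) * rotYMatrix (θ x))) *ᵥ u := by
  choose r θ φ hr using fun y : Q → Fin 2 =>
    exists_rotZ_mul_rotY fun b => v (Function.update y d b)
  have hpiece : DependsOn (fun x : Q → Fin 2 => D.piecewise x 0) D := fun x y hxy =>
    Finset.piecewise_congr D hxy fun _ _ => rfl
  have hpiece_update (x : Q → Fin 2) (b : Fin 2) :
      D.piecewise (Function.update x d b) 0 = D.piecewise x 0 :=
    hpiece fun q hq => Function.update_of_ne (ne_of_mem_of_not_mem hq hd) _ _
  have hsupp (x : Q → Fin 2) :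
      Function.update x d 0 = D.piecewise x 0 ↔ Set.EqOn x 0 (insert d D : Set Q)ᶜ := by
    refine funext_iff.trans (forall_congr' fun q => ?_)
    obtain rfl | hq := eq_or_ne q d
    · simp [hd]
    · by_cases hqD : q ∈ D <;> simp [hq, hqD]
  refine ⟨fun x => if x = D.piecewise x 0 then r x else 0, fun x => θ (D.piecewise x 0),
    fun x => φ (D.piecewise x 0), fun x hx q hq => ?_, fun x y h => congrArg θ (hpiece h),
    fun x y h => congrArg φ (hpiece h), funext fun x => ?_⟩
  · rw [(ite_ne_right_iff.1 hx).1]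
    exact Finset.piecewise_eq_of_notMem _ _ _ hq
  · have hone : Function.update x d 1 ≠ D.piecewise x 0 := fun h => by simpa [hd] using congrFun h d
    rw [multiplex_mulVec_apply, onQubit_mulVec_apply, Fin.sum_univ_two, hpiece_update,
      hpiece_update, if_neg hone, mul_zero, add_zero]
    by_cases hx : Set.EqOn x 0 (insert d D : Set Q)ᶜ
    · have hv' := hr (D.piecewise x 0) (x d)
      nth_rw 1 [← (hsupp x).2 hx] at hv'
      rw [Function.update_idem, Function.update_eq_self] at hv'
      rw [if_pos ((hsupp x).2 hx), (hsupp x).2 hx]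
      exact hv'
    · rw [if_neg (mt (hsupp x).1 hx), mul_zero]
      exact not_imp_comm.1 (hv x) hx

theorem exists_circuit_prepare {D : Finset Q} {v : (Q → Fin 2) → ℂ}
    (hv : ∀ x, v x ≠ 0 → Set.EqOn x 0 (D : Set Q)ᶜ) :
    ∃ (C : List (Gate Q)) (c : ℂ), v = c • circuitMatrix C *ᵥ Pi.single 0 1 ∧
      C.length ≤ 6 * 2 ^ D.card := by
  induction D using Finset.induction_on generalizing v with
  | empty =>
    refine ⟨[], v 0, ?_, by simp⟩
    ext x
    by_cases hx : x = 0
    · simp [hx, circuitMatrix]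
    · simp [circuitMatrix, hx, not_imp_comm.1 (hv x) fun h => hx (funext fun q => h (by simp))]
  | insert d D hd ih =>
    rw [Finset.coe_insert] at hv
    obtain ⟨u, θ, φ, hu, hθ, hφ, hvu⟩ := exists_eq_multiplex_mulVec hd hv
    obtain ⟨C, c, hC, hl⟩ := ih hu
    obtain ⟨CY, hY, hYl⟩ := exists_circuit_multiplex_rotY hd hθ
    obtain ⟨CZ, hZ, hZl⟩ := exists_circuit_multiplex_rotZ hd hφ
    refine ⟨C ++ (CY ++ CZ), c, ?_, ?_⟩
    · rw [circuitMatrix_append, circuitMatrix_append, ← mulVec_mulVec, ← mulVec_smul, ← hC, hY, hZ,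
        multiplex_mul (fun x => preservesQubits_onQubit hd _) fun x y h => by rw [hθ h], hvu]
      simp only [onQubit_mul]
    · rw [Finset.card_insert_of_notMem hd, pow_succ]
      simp only [List.length_append]
      omega

theorem exists_circuit_prepare_of_dotProduct_eq_one {v : (Q → Fin 2) → ℂ}
    (hv : star v ⬝ᵥ v = 1) :
    ∃ (C : List (Gate Q)) (c : ℂ), star c * c = 1 ∧ v = c • circuitMatrix C *ᵥ Pi.single 0 1 ∧
      C.length ≤ 6 * 2 ^ Fintype.card Q := by
  obtain ⟨C, c, hC, hl⟩ := exists_circuit_prepare (D := Finset.univ) (v := v) fun x _ => by simp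
  refine ⟨C, c, ?_, hC, hl⟩
  rw [← hv, hC, star_smul, smul_dotProduct, dotProduct_smul, star_mulVec, dotProduct_mulVec,
    vecMul_vecMul, ← star_eq_conjTranspose,
    mem_unitaryGroup_iff'.1 (circuitMatrix_mem_unitaryGroup C)]
  simp [mul_comm]

end StatePreparation

/-! ### Work qubits -/

section WorkQubits

variable {Q W : Type} [Fintype Q] [Fintype W]

/-- The isometry `|y⟩ ↦ |y⟩ ⊗ |g y⟩`, which puts the work qubits `W` into the state `g y`. -/
def loadWork (g : (Q → Fin 2) → W → Fin 2) :
    Matrix (Q ⊕ W → Fin 2) (Q → Fin 2) ℂ :=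
  of fun x y => if x = Sum.elim y (g y) then 1 else 0

variable [DecidableEq Q]

theorem loadWork_mul_apply (g : (Q → Fin 2) → W → Fin 2) (U : Op Q) (x : Q ⊕ W → Fin 2)
    (y : Q → Fin 2) :
    (loadWork g * U) x y = if x ∘ Sum.inr = g (x ∘ Sum.inl) then U (x ∘ Sum.inl) y else 0 := by
  have h : ∀ z, x = Sum.elim z (g z) ↔ x ∘ Sum.inl = z ∧ x ∘ Sum.inr = g (x ∘ Sum.inl) := by
    refine fun z => ⟨fun hx => ?_, fun ⟨hl, hr⟩ => ?_⟩
    · rw [hx, Sum.elim_comp_inl, Sum.elim_comp_inr]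
      exact ⟨rfl, rfl⟩
    · rw [← Sum.elim_comp_inl_inr x, hr, hl]
  simp [mul_apply, loadWork, h, ite_and]

variable [DecidableEq W]

/-- The circuit `C` acts as `U` on `Q` whenever the work qubits are in the state `g y` given by
the basis state `y` of `Q`, and it restores them. -/
def ImplementsWith (g : (Q → Fin 2) → W → Fin 2) (C : List (Gate (Q ⊕ W))) (U : Op Q) : Prop :=
  circuitMatrix C * loadWork g = loadWork g * U

variable {g g' : (Q → Fin 2) → W → Fin 2} {a : W → Fin 2} {C D : List (Gate (Q ⊕ W))} {U V : Op Q}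

theorem mul_loadWork_apply (M : Op (Q ⊕ W)) (x : Q ⊕ W → Fin 2) (y : Q → Fin 2) :
    (M * loadWork g) x y = M x (Sum.elim y (g y)) := by
  simp [mul_apply, loadWork]

theorem implements_iff_implementsWith : Implements C U ↔ ImplementsWith (fun _ => 0) C U := by
  rw [ImplementsWith, ← Matrix.ext_iff]
  simp only [mul_loadWork_apply, loadWork_mul_apply]
  refine ⟨fun h x y => ?_, fun h x y z => h (Sum.elim x z) y⟩
  rw [← h, Sum.elim_comp_inl_inr]
  rfl

theorem ImplementsWith.append (hC : ImplementsWith g C U) (hD : ImplementsWith g D V) :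
    ImplementsWith g (C ++ D) (V * U) := by
  rw [ImplementsWith, circuitMatrix_append, Matrix.mul_assoc, hC, ← Matrix.mul_assoc, hD,
    Matrix.mul_assoc]

theorem ImplementsWith.conj (hC : ImplementsWith g' C U)
    (hD : circuitMatrix D * loadWork g = loadWork g') :
    ImplementsWith g (D ++ (C ++ invCircuit D)) U := by
  have hD' : circuitMatrix (invCircuit D) * loadWork g' = loadWork g := by
    rw [← hD, ← Matrix.mul_assoc, circuitMatrix_invCircuit, ← star_eq_conjTranspose,
      mem_unitaryGroup_iff'.1 (circuitMatrix_mem_unitaryGroup D), Matrix.one_mul]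
  rw [ImplementsWith, circuitMatrix_append, circuitMatrix_append, Matrix.mul_assoc, hD,
    Matrix.mul_assoc, hC, ← Matrix.mul_assoc, hD']

theorem implementsWith_multiplex {s : Set Q} {V : (Q → Fin 2) → Op Q}
    (hC : ∀ y, ImplementsWith (fun _ => g y) C (V y)) (hg : DependsOn g s)
    (hV : ∀ y, PreservesQubits s (V y)) (hVs : DependsOn V s) :
    ImplementsWith g C (multiplex V) := by
  ext x y
  have hCy := congrFun₂ (hC y) x y
  rw [mul_loadWork_apply, loadWork_mul_apply] at hCy
  rw [mul_loadWork_apply, hCy, loadWork_mul_apply, multiplex_apply_right hV hVs]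
  by_cases h : Set.EqOn (x ∘ Sum.inl) y s
  · rw [hg h]
  · simp only [(hV y).apply_eq_zero h, ite_self]

theorem implementsWith_of_eq_multiplex {V : (Q ⊕ W → Fin 2) → Op Q}
    (hC : circuitMatrix C = multiplex fun x => onQubits .inl (V x)) (a : W → Fin 2) :
    ImplementsWith (fun _ => a) C (multiplex fun y => V (Sum.elim y a)) := by
  classical
  ext x y
  have hx : Set.EqOn x (Sum.elim y a) (Set.range Sum.inl)ᶜ ↔ x ∘ Sum.inr = a := by
    simp [Set.EqOn, funext_iff]
  simp only [mul_loadWork_apply, loadWork_mul_apply, hC, multiplex, of_apply, onQubits_apply]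
  by_cases h : x ∘ Sum.inr = a
  · subst h
    rw [if_pos rfl, Sum.elim_comp_inl_inr]
    exact if_pos (hx.2 rfl)
  · rw [if_neg h]
    exact if_neg (mt hx.1 h)

theorem implementsWith_map_inl (C : List (Gate Q)) (a : W → Fin 2) :
    ImplementsWith (fun _ => a) (C.map (Gate.map .inl)) (circuitMatrix C) :=
  implementsWith_of_eq_multiplex (V := fun _ => circuitMatrix C) (circuitMatrix_map .inl C) a

theorem implementsWith_controlled {c : W}
    (hC : circuitMatrix C = controlled (.inr c) (onQubits .inl U))
    (a : W → Fin 2) : ImplementsWith (fun _ => a) C (if a c = 1 then U else 1) :=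
  implementsWith_of_eq_multiplex (V := fun x => if x (.inr c) = 1 then U else 1)
    (by simp only [apply_ite (onQubits _), onQubits_one, hC, controlled]) a

end WorkQubits

/-! ### Unary iteration -/

section UnaryIteration

variable {Q W : Type}

theorem preservesQubits_multiplex_cons {k : ℕ} {b : Fin (k + 1) → Q}
    {V : (Fin (k + 1) → Fin 2) → Op Q} (hV : ∀ l, PreservesQubits (Set.range b) (V l))
    (β : Fin 2) :
    PreservesQubits {b 0} (multiplex fun x => V (Fin.cons β (x ∘ Fin.tail b))) := fun _ _ h =>
  (hV _ h).mono (Set.singleton_subset_iff.2 (Set.mem_range_self 0))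

variable [Fintype Q] [DecidableEq Q]

theorem multiplex_cons_mul_multiplex_cons {k : ℕ} {b : Fin (k + 1) → Q}
    {V : (Fin (k + 1) → Fin 2) → Op Q} (hV : ∀ l, PreservesQubits (Set.range b) (V l))
    (p : Prop) [Decidable p] :
    multiplex (fun y => if p ∧ y (b 0) = 1 then
        multiplex fun x => V (Fin.cons 1 (x ∘ Fin.tail b)) else 1) *
      multiplex (fun y => if p ∧ y (b 0) = 0 then
        multiplex fun x => V (Fin.cons 0 (x ∘ Fin.tail b)) else 1) =
      if p then multiplex (fun x => V (x ∘ b)) else 1 := by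
  rw [multiplex_mul (s := {b 0})]
  · ext x y
    by_cases hp : p
    · have hcons : x ∘ b = Fin.cons (x (b 0)) (x ∘ Fin.tail b) :=
        (Fin.cons_self_tail (x ∘ b)).symm
      obtain h | h : x (b 0) = 0 ∨ x (b 0) = 1 := by omega
      all_goals simp [multiplex, hp, h, hcons]
    · simp [multiplex, hp]
  · intro y
    split_ifs
    exacts [preservesQubits_multiplex_cons hV 1, preservesQubits_one]
  · intro x y h
    simp only [h (b 0) rfl]

variable [Fintype W] [DecidableEq W]

theorem exists_circuit_mul_loadWork {p e : W} (hpe : p ≠ e) (q : Q) (β : Fin 2) :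
    ∃ C : List (Gate (Q ⊕ W)), C.length ≤ 12 ∧ ∀ a : W → Fin 2, a e = 0 →
      circuitMatrix C * loadWork (Q := Q) (fun _ => a) =
        loadWork fun y => Function.update a e (if a p = 1 ∧ y q = β then 1 else 0) := by
  obtain ⟨C, hl, hC⟩ := exists_circuit_compute (Q := Q ⊕ W) (c := .inr e)
    (D := {.inr p, .inl q}) (P := fun x => x (.inr p) = 1 ∧ x (.inl q) = β)
    (by simpa using hpe.symm) fun x y h => by
      simp only [h (.inr p) (by simp), h (.inl q) (by simp)]
  rw [Finset.card_pair Sum.inr_ne_inl] at hl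
  refine ⟨C, hl, fun a ha => ?_⟩
  ext x y
  rw [mul_loadWork_apply, hC _ _ ha, loadWork, of_apply, Sum.update_elim_inr]
  rfl

theorem exists_circuit_controlled_by_bit {p e : W} (hpe : p ≠ e) (q : Q) (β : Fin 2)
    (F : List (Gate (Q ⊕ W))) {V : Op Q} (hV : PreservesQubits {q} V) :
    ∃ G : List (Gate (Q ⊕ W)), G.length ≤ F.length + 24 ∧ ∀ a : W → Fin 2, a e = 0 →
      (∀ b, ImplementsWith (fun _ => Function.update a e b) F (if b = 1 then V else 1)) →
      ImplementsWith (fun _ => a) G (multiplex fun y => if a p = 1 ∧ y q = β then V else 1) := by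
  obtain ⟨C, hl, hC⟩ := exists_circuit_mul_loadWork hpe q β
  refine ⟨C ++ (F ++ invCircuit C), ?_, fun a ha hF => ?_⟩
  · simp only [List.length_append, length_invCircuit]
    omega
  · refine (implementsWith_multiplex (s := {q}) (fun y => ?_) (fun x y h => ?_) (fun y => ?_)
      fun x y h => ?_).conj (hC a ha)
    · convert hF (if a p = 1 ∧ y q = β then 1 else 0) using 1
      simp
    · simp only [h q rfl]
    · split_ifs
      exacts [hV, preservesQubits_one]
    · simp only [h q rfl]

/-- The work qubits `w 1, …, w k` hold the partial conjunctions of `w 0` with the tests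
`x (b i) = l i`. All leaves below a node of the binary tree of partial labels share its conjunction,
hence an overhead of `48` gates per leaf rather than one of order `k`. -/
theorem exists_circuit_unaryIteration {L k : ℕ} {w : Fin (k + 1) → W} (hw : w.Injective)
    (b : Fin k → Q) {V : (Fin k → Fin 2) → Op Q}
    (hV : ∀ l, PreservesQubits (Set.range b) (V l))
    (hleaf : ∀ l, ∃ F : List (Gate (Q ⊕ W)), F.length ≤ L ∧
      ∀ a, ImplementsWith (fun _ => a) F (if a (w (Fin.last k)) = 1 then V l else 1)) :
    ∃ C : List (Gate (Q ⊕ W)), C.length + 48 ≤ 2 ^ k * (L + 48) ∧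
      ∀ a, (∀ i : Fin k, a (w i.succ) = 0) → ImplementsWith (fun _ => a) C
        (if a (w 0) = 1 then multiplex (fun x => V (x ∘ b)) else 1) := by
  induction k with
  | zero =>
    obtain ⟨F, hl, hF⟩ := hleaf ![]
    refine ⟨F, by omega, fun a _ => ?_⟩
    have hVb : multiplex (fun x => V (x ∘ b)) = V ![] := by
      ext x y
      rw [multiplex, of_apply, Subsingleton.elim (x ∘ b) ![]]
    rw [hVb]
    exact hF a
  | succ k ih =>
    have hbranch (β : Fin 2) := ih (hw.comp (Fin.succ_injective _)) (Fin.tail b)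
      (V := fun l => V (Fin.cons β l))
      (fun l x y h => (hV _ h).mono (Set.range_comp_subset_range _ _))
      fun l => hleaf (Fin.cons β l)
    have hw01 : w 0 ≠ w 1 := hw.ne (by simp)
    obtain ⟨F₀, hl₀, hF₀⟩ := hbranch 0
    obtain ⟨F₁, hl₁, hF₁⟩ := hbranch 1
    obtain ⟨G₀, hlG₀, hG₀⟩ := exists_circuit_controlled_by_bit hw01 (b 0) 0 F₀
      (preservesQubits_multiplex_cons hV 0)
    obtain ⟨G₁, hlG₁, hG₁⟩ := exists_circuit_controlled_by_bit hw01 (b 0) 1 F₁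
      (preservesQubits_multiplex_cons hV 1)
    refine ⟨G₀ ++ G₁, ?_, fun a ha => ?_⟩
    · rw [List.length_append, pow_succ, mul_right_comm]
      omega
    · have hupdate (b : Fin 2) (i : Fin k) : Function.update a (w 1) b (w i.succ.succ) = 0 := by
        rw [Function.update_of_ne (hw.ne (by simp [Fin.ext_iff])), ha]
      rw [← multiplex_cons_mul_multiplex_cons hV]
      refine (hG₀ a (ha 0) fun b => ?_).append (hG₁ a (ha 0) fun b => ?_)
      · simpa using hF₀ _ (hupdate b)
      · simpa using hF₁ _ (hupdate b)

end UnaryIteration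

/-! ### Dilations -/

section AncillaRotation

variable {K : Type} [Fintype K] [DecidableEq K]

/-- A basis state of the qubits `K` and one ancilla as a pair. -/
def splitAncilla (K : Type) : (K ⊕ Unit → Fin 2) ≃ (K → Fin 2) × Fin 2 :=
  (Equiv.sumArrowEquivProdArrow K Unit (Fin 2)).trans
    ((Equiv.refl _).prodCongr (Equiv.funUnique Unit (Fin 2)))

theorem onQubits_inl_eq_submatrix_kronecker (M : Op K) :
    onQubits .inl M = (M ⊗ₖ (1 : Matrix (Fin 2) (Fin 2) ℂ)).submatrix
      (splitAncilla K) (splitAncilla K) := by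
  classical
  ext x y
  have h : Set.EqOn x y (Set.range (Function.Embedding.inl : K ↪ K ⊕ Unit))ᶜ ↔
      x (.inr ()) = y (.inr ()) := by simp [Set.EqOn, Unique.forall_iff]
  simp only [onQubits_apply, submatrix_apply, kroneckerMap_apply, one_apply, mul_ite, mul_one,
    mul_zero, h]
  rfl

theorem onQubit_inr_eq_submatrix_kronecker (N : Matrix (Fin 2) (Fin 2) ℂ) :
    onQubit (.inr ()) N = ((1 : Op K) ⊗ₖ N).submatrix (splitAncilla K) (splitAncilla K) := by
  ext x y
  simp only [onQubit, of_apply, submatrix_apply, kroneckerMap_apply, one_apply, ite_mul, one_mul,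
    zero_mul]
  exact if_congr (by simp [splitAncilla, funext_iff]) rfl rfl

theorem onQubits_inl_mul_onQubit_inr_apply (M : Op K) (N : Matrix (Fin 2) (Fin 2) ℂ)
    (x y : K ⊕ Unit → Fin 2) :
    (onQubits .inl M * onQubit (.inr ()) N : Op (K ⊕ Unit)) x y =
      M (x ∘ .inl) (y ∘ .inl) * N (x (.inr ())) (y (.inr ())) := by
  rw [onQubits_inl_eq_submatrix_kronecker, onQubit_inr_eq_submatrix_kronecker, submatrix_mul_equiv,
    ← mul_kronecker_mul, mul_one, one_mul]
  rfl

theorem commute_onQubit_inr_onQubits_inl (M : Op K) (N : Matrix (Fin 2) (Fin 2) ℂ) :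
    Commute (onQubit (Sum.inr () : K ⊕ Unit) N) (onQubits .inl M) := by
  rw [Commute, SemiconjBy, onQubits_inl_eq_submatrix_kronecker, onQubit_inr_eq_submatrix_kronecker]
  simp only [submatrix_mul_equiv, ← mul_kronecker_mul, mul_one, one_mul]

/-- The ancilla rotated about the `Y` axis by the angle `θ x`, where `x` is the state of the
qubits `K`. -/
noncomputable def ancillaRotation (θ : (K → Fin 2) → ℝ) : Op (K ⊕ Unit) :=
  multiplex fun x => onQubit (.inr ()) (rotYMatrix (θ (x ∘ .inl)))

theorem ancillaRotation_zero : ancillaRotation (0 : (K → Fin 2) → ℝ) = 1 := by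
  simp only [ancillaRotation, Pi.zero_apply, rotYMatrix_zero, onQubit_one]
  rfl

theorem ancillaRotation_add (θ φ : (K → Fin 2) → ℝ) :
    ancillaRotation (θ + φ) = ancillaRotation θ * ancillaRotation φ := by
  unfold ancillaRotation
  rw [multiplex_mul (s := Set.range Sum.inl)]
  · simp only [Pi.add_apply, ← rotYMatrix_mul, onQubit_mul]
  · exact fun x => preservesQubits_onQubit (by simp) _
  · exact dependsOn_comp_range Sum.inl fun u => onQubit (.inr () : K ⊕ Unit) (rotYMatrix (φ u))

theorem ancillaRotation_mem_unitaryGroup (θ : (K → Fin 2) → ℝ) :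
    ancillaRotation θ ∈ unitaryGroup (K ⊕ Unit → Fin 2) ℂ :=
  multiplex_mem_unitaryGroup (s := Set.range Sum.inl)
    (fun _ => preservesQubits_onQubit (by simp) _)
    (dependsOn_comp_range Sum.inl fun u => onQubit (.inr () : K ⊕ Unit) (rotYMatrix (θ u)))
    fun _ => onQubit_mem_unitaryGroup _ (rotYMatrix_mem_unitaryGroup _)

theorem ancillaRotation_apply (θ : (K → Fin 2) → ℝ) (x y : K ⊕ Unit → Fin 2) :
    ancillaRotation θ x y = if x ∘ Sum.inl = y ∘ Sum.inl then
      rotYMatrix (θ (x ∘ .inl)) (x (.inr ())) (y (.inr ())) else 0 := by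
  rw [ancillaRotation, multiplex, of_apply, onQubit, of_apply]
  exact if_congr (by simp [funext_iff]) rfl rfl

theorem ancillaRotation_eq (θ : (K → Fin 2) → ℝ) :
    ancillaRotation θ = onQubits .inl (diagonal fun x => (Real.cos (θ x / 2) : ℂ)) +
      onQubits .inl (diagonal fun x => (Real.sin (θ x / 2) : ℂ)) *
        onQubit (.inr ()) (rotYMatrix Real.pi) := by
  rw [← mul_one (onQubits .inl (diagonal fun x => (Real.cos (θ x / 2) : ℂ))),
    ← onQubit_one (Sum.inr () : K ⊕ Unit)]
  ext x y
  rw [Matrix.add_apply, onQubits_inl_mul_onQubit_inr_apply, onQubits_inl_mul_onQubit_inr_apply,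
    ancillaRotation_apply, diagonal_apply, diagonal_apply]
  split_ifs
  · generalize x (.inr ()) = a, y (.inr ()) = b
    fin_cases a <;> fin_cases b <;> simp [rotYMatrix]
  · simp

theorem ancillaRotation_single (i : K → Fin 2) (a : ℝ) :
    ancillaRotation (Pi.single i a) =
      1 + onQubits .inl (single i i 1) * (onQubit (.inr ()) (rotYMatrix a) - 1) := by
  ext x y
  rw [ancillaRotation, multiplex, of_apply, Matrix.add_apply, onQubits_single_self_mul_apply,
    Matrix.sub_apply]
  change _ = _ + if x ∘ Sum.inl = i then _ else _
  by_cases h : x ∘ Sum.inl = i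
  · simp [h]
  · simp [h, rotYMatrix_zero, onQubit_one]

/-- The rotation of the ancilla about the `Y` axis by the angle `θ i` when the qubits `K` are in the
state given by the column `i` of `U`. -/
noncomputable def ancillaRotationIn (U : Op K) (θ : (K → Fin 2) → ℝ) : Op (K ⊕ Unit) :=
  onQubits .inl U * ancillaRotation θ * onQubits .inl Uᴴ

variable {U : Op K}

theorem ancillaRotationIn_mem_unitaryGroup (hU : U ∈ unitaryGroup (K → Fin 2) ℂ)
    (θ : (K → Fin 2) → ℝ) : ancillaRotationIn U θ ∈ unitaryGroup (K ⊕ Unit → Fin 2) ℂ :=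
  mul_mem (mul_mem (onQubits_mem_unitaryGroup _ hU) (ancillaRotation_mem_unitaryGroup θ))
    (onQubits_mem_unitaryGroup _ (Unitary.star_mem hU))

theorem ancillaRotationIn_zero (hU : U ∈ unitaryGroup (K → Fin 2) ℂ) :
    ancillaRotationIn U 0 = 1 := by
  rw [ancillaRotationIn, ancillaRotation_zero, mul_one, ← onQubits_mul, ← star_eq_conjTranspose,
    mem_unitaryGroup_iff.1 hU, onQubits_one]

theorem ancillaRotationIn_add (hU : U ∈ unitaryGroup (K → Fin 2) ℂ) (θ φ : (K → Fin 2) → ℝ) :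
    ancillaRotationIn U (θ + φ) = ancillaRotationIn U θ * ancillaRotationIn U φ := by
  have hone : onQubits (.inl : K ↪ K ⊕ Unit) Uᴴ * onQubits .inl U = 1 := by
    rw [← onQubits_mul, ← star_eq_conjTranspose, mem_unitaryGroup_iff'.1 hU, onQubits_one]
  simp only [ancillaRotationIn, ancillaRotation_add, mul_assoc]
  rw [← mul_assoc (onQubits .inl Uᴴ), hone, one_mul]

theorem ancillaRotationIn_single (hU : U ∈ unitaryGroup (K → Fin 2) ℂ) (i : K → Fin 2) (a : ℝ) :
    ancillaRotationIn U (Pi.single i a) =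
      1 + onQubits .inl (U * single i i 1 * Uᴴ) * (onQubit (.inr ()) (rotYMatrix a) - 1) := by
  have hone : onQubits (.inl : K ↪ K ⊕ Unit) U * onQubits .inl Uᴴ = 1 := by
    rw [← onQubits_mul, ← star_eq_conjTranspose, mem_unitaryGroup_iff.1 hU, onQubits_one]
  have hcomm : Commute (onQubit (.inr ()) (rotYMatrix a) - 1) (onQubits .inl Uᴴ) :=
    (commute_onQubit_inr_onQubits_inl _ _).sub_left (Commute.one_left _)
  rw [ancillaRotationIn, ancillaRotation_single, mul_add, mul_one, add_mul, hone, onQubits_mul,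
    onQubits_mul, ← mul_assoc, mul_assoc _ _ (onQubits .inl Uᴴ), hcomm.eq, ← mul_assoc]

end AncillaRotation

section ControlledRotation

variable {K Q : Type} [Fintype K] [DecidableEq K] [Fintype Q] [DecidableEq Q]

theorem exists_circuit_mul_single_mul {U : Op K} (hU : U ∈ unitaryGroup (K → Fin 2) ℂ)
    (i : K → Fin 2) :
    ∃ C : List (Gate K), U * single i i 1 * Uᴴ =
      circuitMatrix C * single 0 0 1 * (circuitMatrix C)ᴴ ∧ C.length ≤ 6 * 2 ^ Fintype.card K := by
  have hproj (A : Op K) (j : K → Fin 2) :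
      A * single j j 1 * Aᴴ = vecMulVec (A *ᵥ Pi.single j 1) (star (A *ᵥ Pi.single j 1)) := by
    rw [single_eq_single_vecMulVec_single, mul_vecMulVec, vecMulVec_mul, star_mulVec,
      ← Pi.single_star, star_one]
  have hunit : star (U *ᵥ Pi.single i 1) ⬝ᵥ U *ᵥ Pi.single i 1 = 1 := by
    rw [star_mulVec, dotProduct_mulVec, vecMul_vecMul, ← star_eq_conjTranspose,
      mem_unitaryGroup_iff'.1 hU]
    simp
  obtain ⟨C, c, hc, hC, hl⟩ := exists_circuit_prepare_of_dotProduct_eq_one hunit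
  refine ⟨C, ?_, hl⟩
  rw [hproj, hproj, hC, star_smul, smul_vecMulVec, vecMulVec_smul, smul_smul, mul_comm, hc,
    one_smul]

theorem exists_circuit_controlled_ancillaRotation_single {g : K ⊕ Unit ↪ Q} {c : Q}
    (hc : c ∉ Set.range g) (i : K → Fin 2) (a : ℝ) :
    ∃ C : List (Gate Q), circuitMatrix C =
        controlled c (onQubits g (ancillaRotation (Pi.single i a))) ∧
      C.length ≤ 6 * 2 ^ Fintype.card K := by
  let D : Finset Q := insert c (Finset.univ.map (Function.Embedding.inl.trans g))
  have hD : D.card = Fintype.card K + 1 := by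
    rw [Finset.card_insert_of_notMem, Finset.card_map, Finset.card_univ]
    simpa using fun k hk => hc ⟨_, hk⟩
  have ht : g (.inr ()) ∉ D := by
    simpa [D] using fun h => hc ⟨_, h⟩
  let θ : (K → Fin 2) → ℝ := Pi.single i a
  have hθ : DependsOn (fun x : Q → Fin 2 => if x c = 1 then θ (x ∘ g ∘ Sum.inl) else 0) D := by
    intro x y h
    have hxy : x ∘ g ∘ Sum.inl = y ∘ g ∘ Sum.inl := funext fun k => h _ (by simp [D])
    simp only [h c (by simp [D]), hxy]
  obtain ⟨C, hC, hl⟩ := exists_circuit_multiplex_rotY ht hθ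
  refine ⟨C, ?_, ?_⟩
  · rw [hC, ancillaRotation, onQubits_multiplex]
    ext x y
    simp only [controlled, multiplex, of_apply, onQubits_onQubit]
    split_ifs
    · rfl
    · rw [rotYMatrix_zero, onQubit_one]
  · rw [hD, pow_succ] at hl
    omega

variable {U : Op K} {g : K ⊕ Unit ↪ Q} {c : Q}

theorem exists_circuit_controlled_ancillaRotationIn_single
    (hU : U ∈ unitaryGroup (K → Fin 2) ℂ) (hc : c ∉ Set.range g) (i : K → Fin 2) (a : ℝ) :
    ∃ C : List (Gate Q), circuitMatrix C =
        controlled c (onQubits g (ancillaRotationIn U (Pi.single i a))) ∧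
      C.length ≤ 18 * 2 ^ Fintype.card K := by
  obtain ⟨P, hP, hPl⟩ := exists_circuit_mul_single_mul hU i
  obtain ⟨R, hR, hRl⟩ := exists_circuit_controlled_ancillaRotation_single hc 0 a
  let P' : List (Gate Q) := P.map (Gate.map (Function.Embedding.inl.trans g))
  have hP' : circuitMatrix P' = onQubits g (onQubits .inl (circuitMatrix P)) := by
    rw [circuitMatrix_map, onQubits_onQubits]
  have hone : circuitMatrix P' * (circuitMatrix P')ᴴ = 1 :=
    mem_unitaryGroup_iff.1 (circuitMatrix_mem_unitaryGroup P')
  have hpres (M : Op (K ⊕ Unit)) : PreservesQubits {c} (onQubits g M) :=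
    preservesQubits_onQubits (Set.disjoint_singleton_left.2 hc) M
  refine ⟨invCircuit P' ++ (R ++ P'), ?_, ?_⟩
  · rw [circuitMatrix_append, circuitMatrix_append, circuitMatrix_invCircuit, hR,
      mul_controlled_mul (by rw [hP']; exact hpres _) (hpres _) hone, hP',
      ancillaRotationIn_single hU, hP,
      ← ancillaRotationIn_single (circuitMatrix_mem_unitaryGroup P), ancillaRotationIn,
      onQubits_mul, onQubits_mul, onQubits_conjTranspose, onQubits_conjTranspose]
  · simp only [List.length_append, length_invCircuit, P', List.length_map]
    omega

theorem exists_circuit_controlled_ancillaRotationIn (hU : U ∈ unitaryGroup (K → Fin 2) ℂ)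
    (hc : c ∉ Set.range g) (θ : (K → Fin 2) → ℝ) :
    ∃ C : List (Gate Q), circuitMatrix C = controlled c (onQubits g (ancillaRotationIn U θ)) ∧
      C.length ≤ 18 * 4 ^ Fintype.card K := by
  suffices h : ∀ s : Finset (K → Fin 2), ∃ C : List (Gate Q), circuitMatrix C =
      controlled c (onQubits g (ancillaRotationIn U (∑ i ∈ s, Pi.single i (θ i)))) ∧
      C.length ≤ s.card * (18 * 2 ^ Fintype.card K) by
    obtain ⟨C, hC, hl⟩ := h Finset.univ
    rw [Finset.univ_sum_single] at hC
    refine ⟨C, hC, hl.trans_eq ?_⟩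
    rw [Finset.card_univ, Fintype.card_fun, Fintype.card_fin, mul_left_comm, ← mul_pow]
    norm_num
  intro s
  induction s using Finset.induction_on with
  | empty =>
    refine ⟨[], ?_, by simp⟩
    rw [Finset.sum_empty, ancillaRotationIn_zero hU, onQubits_one, controlled_one, circuitMatrix]
  | insert i s hi ih =>
    obtain ⟨C, hC, hl⟩ := ih
    obtain ⟨D, hD, hDl⟩ := exists_circuit_controlled_ancillaRotationIn_single hU hc i (θ i)
    refine ⟨C ++ D, ?_, ?_⟩
    · rw [circuitMatrix_append, hC, hD,
        controlled_mul (preservesQubits_onQubits (Set.disjoint_singleton_left.2 hc) _),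
        ← onQubits_mul, ← ancillaRotationIn_add hU, Finset.sum_insert hi]
    · rw [List.length_append, Finset.card_insert_of_notMem hi, add_mul, one_mul]
      omega

end ControlledRotation

section DilationCircuit

variable {K Q : Type} [Fintype K] [DecidableEq K] [Fintype Q] [DecidableEq Q]

theorem dilation_eq (w : Op K) :
    dilation w = onQubits .inl w + onQubits .inl (CFC.sqrt (1 - w * w)) *
      onQubit (.inr ()) (rotYMatrix Real.pi) := by
  rw [← mul_one (onQubits .inl w), ← onQubit_one (Sum.inr () : K ⊕ Unit)]
  ext x y
  rw [Matrix.add_apply, onQubits_inl_mul_onQubit_inr_apply, onQubits_inl_mul_onQubit_inr_apply]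
  have hx : x (.inr ()) = 0 ∨ x (.inr ()) = 1 := by omega
  have hy : y (.inr ()) = 0 ∨ y (.inr ()) = 1 := by omega
  rcases hx with hx | hx <;> rcases hy with hy | hy <;>
    simp [dilation, rotYMatrix, hx, hy, one_apply]

variable {U w : Op K} {θ : (K → Fin 2) → ℝ}

theorem sqrt_one_sub_conj_diagonal_cos_mul_self (hU : U ∈ unitaryGroup (K → Fin 2) ℂ)
    (hθ : ∀ i, 0 ≤ Real.sin (θ i / 2))
    (hw : w = U * diagonal (fun i => (Real.cos (θ i / 2) : ℂ)) * Uᴴ) :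
    CFC.sqrt (1 - w * w) = U * diagonal (fun i => (Real.sin (θ i / 2) : ℂ)) * Uᴴ := by
  let φ := Unitary.conjStarAlgAut ℂ (Op K) ⟨U, hU⟩
  have hφ (M : Op K) : U * M * Uᴴ = φ M := rfl
  refine CFC.sqrt_unique ?_ ?_
  · rw [hw, hφ, hφ, ← map_mul, ← map_mul, ← map_one φ, ← map_sub, diagonal_mul_diagonal,
      diagonal_mul_diagonal, ← diagonal_one, diagonal_sub]
    congr 2
    funext i
    rw [eq_sub_iff_add_eq, ← sq, ← sq]
    exact_mod_cast Real.sin_sq_add_cos_sq (θ i / 2)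
  · rw [nonneg_iff_posSemidef]
    exact (PosSemidef.diagonal fun i => Complex.zero_le_real.2 (hθ i)).mul_mul_conjTranspose_same U

theorem dilation_eq_ancillaRotationIn (hU : U ∈ unitaryGroup (K → Fin 2) ℂ)
    (hθ : ∀ i, 0 ≤ Real.sin (θ i / 2))
    (hw : w = U * diagonal (fun i => (Real.cos (θ i / 2) : ℂ)) * Uᴴ) :
    dilation w = ancillaRotationIn U θ := by
  rw [dilation_eq, sqrt_one_sub_conj_diagonal_cos_mul_self hU hθ hw, hw, ancillaRotationIn,
    ancillaRotation_eq, mul_add, add_mul]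
  simp only [onQubits_mul, mul_assoc]
  rw [(commute_onQubit_inr_onQubits_inl _ _).eq]

theorem norm_one_sub_le_one_of_posSemidef {h : Op K} (hh : h.PosSemidef) (hn : ‖h‖ ≤ 2) :
    ‖1 - h‖ ≤ 1 := by
  have hsa : IsSelfAdjoint h := hh.1
  have hcfc : 1 - h = cfc (fun x : ℝ => 1 - x) h := by
    rw [cfc_sub _ _, cfc_const_one ℝ h, cfc_id' ℝ h]
  rw [hcfc]
  refine norm_cfc_le zero_le_one fun x hx => ?_
  have h0 : 0 ≤ x := spectrum_nonneg_of_nonneg hh.nonneg hx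
  have h2 : x ≤ 2 := (le_abs_self x).trans ((spectrum.norm_le_norm_of_mem hx).trans hn)
  rw [Real.norm_eq_abs, abs_le]
  constructor <;> linarith

theorem exists_dilation_eq_ancillaRotationIn (hw : w.IsHermitian) (hn : ‖w‖ ≤ 1) :
    ∃ U ∈ unitaryGroup (K → Fin 2) ℂ, ∃ θ, dilation w = ancillaRotationIn U θ := by
  have habs (i) : |hw.eigenvalues i| ≤ 1 :=
    (spectrum.norm_le_norm_of_mem (hw.eigenvalues_mem_spectrum_real i)).trans hn
  let θ : (K → Fin 2) → ℝ := fun i => 2 * Real.arccos (hw.eigenvalues i)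
  have hhalf (i) : θ i / 2 = Real.arccos (hw.eigenvalues i) :=
    mul_div_cancel_left₀ _ two_ne_zero
  have hcos (i) : Real.cos (θ i / 2) = hw.eigenvalues i := by
    rw [hhalf, Real.cos_arccos (abs_le.1 (habs i)).1 (abs_le.1 (habs i)).2]
  have hsin (i) : 0 ≤ Real.sin (θ i / 2) := by
    rw [hhalf]
    exact Real.sin_nonneg_of_nonneg_of_le_pi (Real.arccos_nonneg _) (Real.arccos_le_pi _)
  refine ⟨hw.eigenvectorUnitary, hw.eigenvectorUnitary.2, θ,
    dilation_eq_ancillaRotationIn hw.eigenvectorUnitary.2 hsin ?_⟩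
  simp only [hcos]
  exact hw.spectral_theorem

theorem dilation_mem_unitaryGroup (hw : w.IsHermitian) (hn : ‖w‖ ≤ 1) :
    dilation w ∈ unitaryGroup (K ⊕ Unit → Fin 2) ℂ := by
  obtain ⟨U, hU, θ, hθ⟩ := exists_dilation_eq_ancillaRotationIn hw hn
  rw [hθ]
  exact ancillaRotationIn_mem_unitaryGroup hU θ

theorem exists_circuit_controlled_dilation (hw : w.IsHermitian) (hn : ‖w‖ ≤ 1) {g : K ⊕ Unit ↪ Q}
    {c : Q} (hc : c ∉ Set.range g) :
    ∃ C : List (Gate Q), circuitMatrix C = controlled c (onQubits g (dilation w)) ∧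
      C.length ≤ 18 * 4 ^ Fintype.card K := by
  obtain ⟨U, hU, θ, hθ⟩ := exists_dilation_eq_ancillaRotationIn hw hn
  rw [hθ]
  exact exists_circuit_controlled_ancillaRotationIn hU hc θ

end DilationCircuit

/-! ### Linear combination of unitaries -/

section Label

variable {J : ℕ}

theorem label_injective (J : ℕ) : Function.Injective (label : Fin J → _) := by
  intro i j h
  refine Fin.ext (Nat.eq_of_testBit_eq fun m => ?_)
  by_cases hm : m < ctrlSize J
  · have hbit : (if (i : ℕ).testBit m then 1 else 0 : Fin 2) = if (j : ℕ).testBit m then 1 else 0 :=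
      congrFun h ⟨m, hm⟩
    cases hi : (i : ℕ).testBit m <;> cases hj : (j : ℕ).testBit m <;> simp_all
  · have hJ : J ≤ 2 ^ m := (Nat.le_pow_clog one_lt_two J).trans
      (Nat.pow_le_pow_right two_pos (not_lt.1 hm))
    rw [Nat.testBit_lt_two_pow (i.2.trans_le hJ), Nat.testBit_lt_two_pow (j.2.trans_le hJ)]

theorem two_pow_ctrlSize_le (hJ : 0 < J) : 2 ^ ctrlSize J ≤ 2 * J := by
  have hclog : Nat.clog 2 J ≤ Nat.log 2 J + 1 :=
    Nat.clog_le_of_le_pow (Nat.lt_pow_succ_log_self one_lt_two J).le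
  calc 2 ^ ctrlSize J ≤ 2 ^ (Nat.log 2 J + 1) := Nat.pow_le_pow_right two_pos hclog
    _ = 2 * 2 ^ Nat.log 2 J := pow_succ' 2 _
    _ ≤ 2 * J := Nat.mul_le_mul_left 2 (Nat.pow_log_le_self 2 hJ.ne')

end Label

section Select

variable {n J : ℕ} (S : Fin J → Finset (Fin n)) (h : ∀ j, Op (S j))

/-- The operator that `selectOp` applies when the control register is in the state `l`. -/
noncomputable def selected : (Fin (ctrlSize J) → Fin 2) → Op (Fin n ⊕ Anc J) :=
  Function.extend label (fun j => onQubits (dilationQubits J (S j)) (dilation (1 - h j))) 1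

theorem selected_label (j : Fin J) :
    selected S h (label j) = onQubits (dilationQubits J (S j)) (dilation (1 - h j)) :=
  (label_injective J).extend_apply _ _ j

theorem selected_of_not_exists {l : Fin (ctrlSize J) → Fin 2} (hl : ¬∃ j : Fin J, label j = l) :
    selected S h l = 1 :=
  Function.extend_apply' _ _ l hl

theorem disjoint_range_ctrlQubits_range_dilationQubits (T : Finset (Fin n)) :
    Disjoint (Set.range (ctrlQubits n J)) (Set.range (dilationQubits J T)) := by
  rw [Set.disjoint_right]
  rintro _ ⟨k | k, rfl⟩ ⟨i, hi⟩
  · exact Sum.inr_ne_inl hi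
  · exact Sum.inr_ne_inl (Sum.inr_injective hi)

theorem preservesQubits_selected (l : Fin (ctrlSize J) → Fin 2) :
    PreservesQubits (Set.range (ctrlQubits n J)) (selected S h l) := by
  by_cases hl : ∃ j : Fin J, label j = l
  · obtain ⟨j, rfl⟩ := hl
    rw [selected_label]
    exact preservesQubits_onQubits (disjoint_range_ctrlQubits_range_dilationQubits _) _
  · rw [selected_of_not_exists S h hl]
    exact preservesQubits_one

theorem selectOp_eq_multiplex :
    selectOp S h = multiplex fun x => selected S h (x ∘ ctrlQubits n J) := by
  ext x y
  have hproj (j : Fin J) (A : Op (Fin n ⊕ Anc J)) :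
      (ctrlProj n j * A) x y = if x ∘ ctrlQubits n J = label j then A x y else 0 :=
    onQubits_single_self_mul_apply _ _ _ _ _
  have hproj_one (j : Fin J) :
      ctrlProj n j x y = if x ∘ ctrlQubits n J = label j then (1 : Op _) x y else 0 := by
    rw [← hproj, mul_one]
  rw [selectOp, multiplex, of_apply, Matrix.add_apply, Matrix.sub_apply, Matrix.sum_apply,
    Matrix.sum_apply]
  simp only [hproj, hproj_one]
  by_cases hl : ∃ j : Fin J, label j = x ∘ ctrlQubits n J
  · obtain ⟨j, hj⟩ := hl
    simp [← hj, selected_label, (label_injective J).eq_iff]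
  · have hne (j : Fin J) : x ∘ ctrlQubits n J ≠ label j := fun hj => hl ⟨j, hj.symm⟩
    simp [selected_of_not_exists S h hl, hne]

variable {S h}

theorem selectOp_mem_unitaryGroup (hh : ∀ j, (h j).PosSemidef) (hn : ∀ j, ‖h j‖ ≤ 2) :
    selectOp S h ∈ unitaryGroup (Fin n ⊕ Anc J → Fin 2) ℂ := by
  rw [selectOp_eq_multiplex]
  refine multiplex_mem_unitaryGroup (fun x => preservesQubits_selected S h _)
    (dependsOn_comp_range _ _) fun x => ?_
  by_cases hl : ∃ j : Fin J, label j = x ∘ ctrlQubits n J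
  · obtain ⟨j, hj⟩ := hl
    rw [← hj, selected_label]
    exact onQubits_mem_unitaryGroup _ (dilation_mem_unitaryGroup (isHermitian_one.sub (hh j).1)
      (norm_one_sub_le_one_of_posSemidef (hh j) (hn j)))
  · rw [selected_of_not_exists S h hl]
    exact one_mem _

theorem exists_circuit_controlled_selected {s : ℕ} (hS : ∀ j, (S j).card ≤ s)
    (hh : ∀ j, (h j).PosSemidef) (hn : ∀ j, ‖h j‖ ≤ 2) {W : Type} [Fintype W] [DecidableEq W]
    (c : W) (l : Fin (ctrlSize J) → Fin 2) :
    ∃ C : List (Gate ((Fin n ⊕ Anc J) ⊕ W)), C.length ≤ 18 * 4 ^ s ∧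
      ∀ a, ImplementsWith (fun _ => a) C (if a c = 1 then selected S h l else 1) := by
  by_cases hl : ∃ j : Fin J, label j = l
  · obtain ⟨j, rfl⟩ := hl
    obtain ⟨C, hC, hCl⟩ := exists_circuit_controlled_dilation (isHermitian_one.sub (hh j).1)
      (norm_one_sub_le_one_of_posSemidef (hh j) (hn j))
      (g := (dilationQubits J (S j)).trans .inl) (c := Sum.inr c) (by simp)
    refine ⟨C, hCl.trans ?_, implementsWith_controlled ?_⟩
    · rw [Fintype.card_coe]
      exact Nat.mul_le_mul_left _ (Nat.pow_le_pow_right (by norm_num) (hS j))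
    · rw [hC, selected_label, onQubits_onQubits]
  · refine ⟨[], by simp, fun a => ?_⟩
    rw [selected_of_not_exists S h hl, ite_self, ImplementsWith, circuitMatrix, Matrix.one_mul,
      Matrix.mul_one]

theorem exists_circuit_selectOp {s : ℕ} (hJ : 0 < J) (hS : ∀ j, (S j).card ≤ s)
    (hh : ∀ j, (h j).PosSemidef) (hn : ∀ j, ‖h j‖ ≤ 2) :
    ∃ C : List (Gate ((Fin n ⊕ Anc J) ⊕ Fin (ctrlSize J + 1))),
      ImplementsWith (fun _ => 0) C (selectOp S h) ∧ C.length ≤ 132 * (J * 4 ^ s) := by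
  obtain ⟨C, hCl, hC⟩ := exists_circuit_unaryIteration (w := id) Function.injective_id
    (ctrlQubits n J) (preservesQubits_selected S h)
    (exists_circuit_controlled_selected hS hh hn (Fin.last (ctrlSize J)))
  let W := Fin (ctrlSize J + 1)
  obtain ⟨X, hXl, hX⟩ := exists_circuit_compute (Q := (Fin n ⊕ Anc J) ⊕ W)
    (c := .inr (0 : W)) (D := ∅) (P := fun _ => True) (by simp) fun _ _ _ => rfl
  have hroot : circuitMatrix X * loadWork (Q := Fin n ⊕ Anc J) (fun _ => (0 : W → Fin 2)) =
      loadWork fun _ => Function.update 0 0 1 := by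
    ext x y
    rw [mul_loadWork_apply, hX _ _ rfl, loadWork, of_apply, Sum.update_elim_inr, if_pos trivial]
  have hselect := hC (Function.update 0 0 1) fun i => by simp
  rw [id, Function.update_self, if_pos rfl, ← selectOp_eq_multiplex] at hselect
  refine ⟨X ++ (C ++ invCircuit X), hselect.conj hroot, ?_⟩
  have hleaf : 18 * 4 ^ s + 48 ≤ 66 * 4 ^ s := by
    have := Nat.one_le_pow s 4 (by norm_num)
    omega
  have hC' : C.length + 48 ≤ 132 * (J * 4 ^ s) :=
    calc C.length + 48 ≤ 2 * J * (66 * 4 ^ s) :=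
          hCl.trans (Nat.mul_le_mul (two_pow_ctrlSize_le hJ) hleaf)
      _ = 132 * (J * 4 ^ s) := by ring
  simp only [List.length_append, length_invCircuit]
  simp only [Finset.card_empty, pow_zero, mul_one] at hXl
  omega

end Select

section UniformPrep

variable {J : ℕ}

theorem ofReal_one_div_sqrt_mul_self (J : ℕ) :
    ((1 / Real.sqrt J : ℝ) : ℂ) * ((1 / Real.sqrt J : ℝ) : ℂ) = 1 / (J : ℂ) := by
  rw [← Complex.ofReal_mul, div_mul_div_comm, Real.mul_self_sqrt (Nat.cast_nonneg _)]
  simp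

theorem star_dotProduct_uniform (hJ : 0 < J) :
    let v : (Fin (ctrlSize J) → Fin 2) → ℂ :=
      ∑ j : Fin J, ((1 / Real.sqrt J : ℝ) : ℂ) • Pi.single (label j) 1
    star v ⬝ᵥ v = 1 := by
  intro v
  have hv (i : Fin J) : v (label i) = ((1 / Real.sqrt J : ℝ) : ℂ) := by
    simp only [v, Finset.sum_apply, Pi.smul_apply, Pi.single_apply, (label_injective J).eq_iff]
    simp
  have hJ' : (J : ℂ) ≠ 0 := Nat.cast_ne_zero.2 hJ.ne'
  calc star v ⬝ᵥ v = ∑ j : Fin J, ((1 / Real.sqrt J : ℝ) : ℂ) * star (v (label j)) := by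
        conv_lhs => rw [show v = ∑ j : Fin J, _ from rfl]
        simp only [dotProduct_sum, dotProduct_smul, dotProduct_single, mul_one, smul_eq_mul]
        rfl
    _ = ∑ _j : Fin J, 1 / (J : ℂ) := Finset.sum_congr rfl fun j _ => by
        rw [hv, ← ofReal_one_div_sqrt_mul_self]
        exact congrArg _ (Complex.conj_ofReal _)
    _ = 1 := by
        rw [Finset.sum_const, Finset.card_univ, Fintype.card_fin, nsmul_eq_mul,
          mul_one_div_cancel hJ']

theorem exists_circuit_isUniformPrep (hJ : 0 < J) :
    ∃ (C : List (Gate (Fin (ctrlSize J)))) (c : ℂ), star c * c = 1 ∧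
      IsUniformPrep J (c • circuitMatrix C) ∧ C.length ≤ 12 * J := by
  obtain ⟨C, c, hc, hC, hl⟩ :=
    exists_circuit_prepare_of_dotProduct_eq_one (star_dotProduct_uniform hJ)
  refine ⟨C, c, hc, ⟨?_, ?_⟩, ?_⟩
  · rw [mem_unitaryGroup_iff', star_smul, smul_mul_smul_comm, hc,
      mem_unitaryGroup_iff'.1 (circuitMatrix_mem_unitaryGroup C), one_smul]
  · rw [smul_mulVec, ← hC]
  · have := two_pow_ctrlSize_le hJ
    rw [Fintype.card_fin] at hl
    omega

end UniformPrep

section ZeroBlock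

variable {Q R : Type} [Fintype Q] [Fintype R]

/-- The isometry `|y⟩ ↦ |y⟩ ⊗ |0⟩`. -/
def loadZero (Q R : Type) [Fintype Q] [Fintype R] : Matrix (Q ⊕ R → Fin 2) (Q → Fin 2) ℂ :=
  loadWork fun _ => 0

variable [DecidableEq Q] [DecidableEq R]

theorem loadWork_conjTranspose_mul_apply {ι : Type*} (g : (Q → Fin 2) → R → Fin 2)
    (M : Matrix (Q ⊕ R → Fin 2) ι ℂ) (x : Q → Fin 2) (i : ι) :
    ((loadWork g)ᴴ * M) x i = M (Sum.elim x (g x)) i := by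
  simp [mul_apply, loadWork, apply_ite]

theorem zeroBlock_eq_loadZero_conjTranspose_mul (M : Op (Q ⊕ R)) :
    zeroBlock M = (loadZero Q R)ᴴ * (M * loadZero Q R) := by
  ext x y
  rw [loadZero, loadWork_conjTranspose_mul_apply, mul_loadWork_apply]
  rfl

end ZeroBlock

section LCU

variable {n J : ℕ}

/-- The isometry `|y⟩ ↦ |y⟩ ⊗ |0⟩ ⊗ |j⟩_c` into the system, the dilation ancilla and the control
register. -/
def loadLabel (n : ℕ) (j : Fin J) : Matrix (Fin n ⊕ Anc J → Fin 2) (Fin n → Fin 2) ℂ :=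
  loadWork fun _ => Sum.elim 0 (label j)

theorem eq_elim_elim_zero_iff (x : Fin n ⊕ Anc J → Fin 2) (y : Fin n → Fin 2)
    (l : Fin (ctrlSize J) → Fin 2) :
    x = Sum.elim y (Sum.elim 0 l) ↔
      Set.EqOn x (Sum.elim y 0) (Set.range (ctrlQubits n J))ᶜ ∧ x ∘ ctrlQubits n J = l := by
  have hctrl (i : Fin (ctrlSize J)) : ctrlQubits n J i = .inr (.inr i) := rfl
  simp [hctrl, Set.EqOn, funext_iff, and_assoc]

theorem onQubits_ctrlQubits_mul_loadZero {had : Op (Fin (ctrlSize J))}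
    (hhad : IsUniformPrep J had) :
    onQubits (ctrlQubits n J) had * loadZero (Fin n) (Anc J) =
      ∑ j : Fin J, ((1 / Real.sqrt J : ℝ) : ℂ) • loadLabel n j := by
  classical
  have hhad_zero (l : Fin (ctrlSize J) → Fin 2) :
      had l 0 = ∑ j : Fin J, if l = label j then ((1 / Real.sqrt J : ℝ) : ℂ) else 0 := by
    simpa [Pi.single_apply] using congrFun hhad.2 l
  ext x y
  rw [loadZero, mul_loadWork_apply, onQubits_apply, show Sum.elim y 0 ∘ ctrlQubits n J = 0 from rfl,
    hhad_zero, Matrix.sum_apply]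
  simp only [Matrix.smul_apply, loadLabel, loadWork, of_apply, eq_elim_elim_zero_iff, smul_eq_mul,
    mul_ite, mul_one, mul_zero, ite_and]
  rw [Finset.sum_ite_irrel, Finset.sum_const_zero]

theorem onQubits_dilationQubits_apply (T : Finset (Fin n)) (w : Op T) (x y : Fin n → Fin 2)
    {a : Anc J → Fin 2} (ha : a (.inl ()) = 0) :
    onQubits (dilationQubits J T) (dilation w) (Sum.elim x a) (Sum.elim y a) =
      localTerm T w x y := by
  classical
  rw [localTerm, onQubits_apply, onQubits_apply]
  refine if_congr ?_ ?_ rfl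
  · simp [dilationQubits, Set.EqOn]
  · simp [dilation, dilationQubits, ha, Function.comp_def]

theorem loadLabel_conjTranspose_mul_selectOp_mul (S : Fin J → Finset (Fin n))
    (h : ∀ j, Op (S j)) (i j : Fin J) :
    (loadLabel n i)ᴴ * (selectOp S h * loadLabel n j) =
      if i = j then localTerm (S i) (1 - h i) else 0 := by
  ext x y
  rw [loadLabel, loadLabel, loadWork_conjTranspose_mul_apply, mul_loadWork_apply,
    selectOp_eq_multiplex, multiplex, of_apply]
  by_cases hij : i = j
  · subst hij
    rw [if_pos rfl, ← onQubits_dilationQubits_apply _ _ _ _ (a := Sum.elim 0 (label i)) rfl,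
      ← selected_label]
    rfl
  · rw [if_neg hij, (preservesQubits_selected S h _).apply_eq_zero]
    · rfl
    · exact fun hxy => hij <| label_injective J <| funext fun q => hxy ⟨q, rfl⟩

theorem localTerm_one_sub (S : Finset (Fin n)) (h : Op S) :
    localTerm S (1 - h) = 1 - localTerm S h := by
  rw [localTerm, onQubits_sub, onQubits_one, localTerm]

theorem zeroBlock_lcuOp (hJ : 0 < J) {had : Op (Fin (ctrlSize J))} (hhad : IsUniformPrep J had)
    (S : Fin J → Finset (Fin n)) (h : ∀ j, Op (S j)) :
    zeroBlock (lcuOp had S h) = 1 - (1 / (J : ℂ)) • ∑ j, localTerm (S j) (h j) := by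
  have hJ' : (J : ℂ) ≠ 0 := Nat.cast_ne_zero.2 hJ.ne'
  have hstar : star ((1 / Real.sqrt J : ℝ) : ℂ) = ((1 / Real.sqrt J : ℝ) : ℂ) :=
    Complex.conj_ofReal _
  calc zeroBlock (lcuOp had S h)
      = (onQubits (ctrlQubits n J) had * loadZero (Fin n) (Anc J))ᴴ *
          (selectOp S h * (onQubits (ctrlQubits n J) had * loadZero (Fin n) (Anc J))) := by
        rw [zeroBlock_eq_loadZero_conjTranspose_mul, lcuOp, onQubits_conjTranspose,
          conjTranspose_mul]
        simp only [Matrix.mul_assoc]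
    _ = (1 / (J : ℂ)) • ∑ j : Fin J, ∑ i : Fin J,
          (loadLabel n i)ᴴ * (selectOp S h * loadLabel n j) := by
        simp only [onQubits_ctrlQubits_mul_loadZero hhad, conjTranspose_sum, conjTranspose_smul,
          hstar, Matrix.sum_mul, Matrix.mul_sum, Matrix.smul_mul, Matrix.mul_smul, smul_smul,
          ofReal_one_div_sqrt_mul_self, Finset.smul_sum]
    _ = (1 / (J : ℂ)) • ∑ j, (1 - localTerm (S j) (h j)) := by
        simp only [loadLabel_conjTranspose_mul_selectOp_mul, Finset.sum_ite_eq', Finset.mem_univ,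
          if_true, localTerm_one_sub]
    _ = 1 - (1 / (J : ℂ)) • ∑ j, localTerm (S j) (h j) := by
        rw [Finset.sum_sub_distrib, smul_sub, Finset.sum_const, Finset.card_univ, Fintype.card_fin,
          ← Nat.cast_smul_eq_nsmul ℂ, smul_smul, one_div_mul_cancel hJ', one_smul]

theorem isMatrixBlockEncoding_lcuOp (hJ : 0 < J) {had : Op (Fin (ctrlSize J))}
    (hhad : IsUniformPrep J had) {S : Fin J → Finset (Fin n)} {h : ∀ j, Op (S j)}
    (hh : ∀ j, (h j).PosSemidef) (hn : ∀ j, ‖h j‖ ≤ 2) :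
    IsMatrixBlockEncoding 1 (Nat.clog 2 J + 1) 0 (lcuOp had S h)
      (1 - (1 / (J : ℂ)) • ∑ j, localTerm (S j) (h j)) := by
  refine ⟨by simp [add_comm], ?_, ?_⟩
  · exact mul_mem (mul_mem (onQubits_mem_unitaryGroup _ (Unitary.star_mem hhad.1))
      (selectOp_mem_unitaryGroup hh hn)) (onQubits_mem_unitaryGroup _ hhad.1)
  · rw [zeroBlock_lcuOp hJ hhad]
    simp

theorem lcuOp_smul {c : ℂ} (hc : star c * c = 1) (had : Op (Fin (ctrlSize J)))
    (S : Fin J → Finset (Fin n)) (h : ∀ j, Op (S j)) :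
    lcuOp (c • had) S h = lcuOp had S h := by
  rw [lcuOp, lcuOp, conjTranspose_smul, onQubits_smul, onQubits_smul, Matrix.smul_mul,
    smul_mul_smul_comm, hc, one_smul]

theorem exists_circuit_lcuOp {s : ℕ} (hJ : 0 < J) {S : Fin J → Finset (Fin n)}
    {h : ∀ j, Op (S j)} (hS : ∀ j, (S j).card ≤ s) (hh : ∀ j, (h j).PosSemidef)
    (hn : ∀ j, ‖h j‖ ≤ 2) :
    ∃ had, IsUniformPrep J had ∧
      ∃ (w : ℕ) (C : List (Gate ((Fin n ⊕ Anc J) ⊕ Fin w))),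
        Implements C (lcuOp had S h) ∧ C.length ≤ 156 * (J * 2 ^ (2 * s)) := by
  obtain ⟨P, c, hc, hP, hPl⟩ := exists_circuit_isUniformPrep hJ
  obtain ⟨F, hF, hFl⟩ := exists_circuit_selectOp hJ hS hh hn
  let P' : List (Gate (Fin n ⊕ Anc J)) := P.map (Gate.map (ctrlQubits n J))
  refine ⟨c • circuitMatrix P, hP, ctrlSize J + 1,
    P'.map (Gate.map .inl) ++ (F ++ (invCircuit P').map (Gate.map .inl)), ?_, ?_⟩
  · rw [implements_iff_implementsWith, lcuOp_smul hc, lcuOp, onQubits_conjTranspose,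
      ← circuitMatrix_map, ← circuitMatrix_invCircuit]
    exact (implementsWith_map_inl P' 0).append (hF.append (implementsWith_map_inl _ 0))
  · have hJs : J ≤ J * 4 ^ s := Nat.le_mul_of_pos_right J (by positivity)
    simp only [List.length_append, List.length_map, length_invCircuit, P', pow_mul]
    norm_num only
    omega

end LCU

end BlockEnc

open BlockEnc in
theorem mainTheorem7 :
    ∃ C : ℕ, ∀ (n s J : ℕ), 0 < J →
      ∀ (S : Fin J → Finset (Fin n)) (h : ∀ j, Op (S j)),
        (∀ j, (S j).card ≤ s) → (∀ j, (h j).PosSemidef) → (∀ j, ‖h j‖ ≤ 2) →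
        ∀ A : Op (Fin n), A = ∑ j, localTerm (S j) (h j) →
          (∀ had, IsUniformPrep J had →
            IsMatrixBlockEncoding 1 (Nat.clog 2 J + 1) 0 (lcuOp had S h)
              (1 - (1 / (J : ℂ)) • A)) ∧
          ∃ had, IsUniformPrep J had ∧
            ∃ (w : ℕ) (circ : List (Gate ((Fin n ⊕ Anc J) ⊕ Fin w))),
              Implements circ (lcuOp had S h) ∧ circ.length ≤ C * (J * 2 ^ (2 * s)) := by
  refine ⟨156, fun n s J hJ S h hS hh hn A hA => ?_⟩
  subst hA
  exact ⟨fun had hhad => isMatrixBlockEncoding_lcuOp hJ hhad hh hn,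
    exists_circuit_lcuOp hJ hS hh hn⟩
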